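/- Let $X$ be a complex Banach space with dual $X'$, let $-\mathrm{i}A$ be the generator of a $C_0$-group $(U_s)_{s\in\mathbb{R}}$ on $X$, let $\omega\ge 0$, and let $v:\mathbb{R}\to[1,\infty)$ be strongly admissible, i.e. $v$ is measurable, $\sup_{s,t\in\mathbb{R}}\frac{v(s+t)}{v(s)+v(t)}<\infty$, and $\frac1v\in L^2(\mathbb{R})$. Let $L^2_{v,\omega}(\mathbb{R})$ be the space of all $g\in L^2(\mathbb{R})$ with $\|g\|_{L^2_{v,\omega}}:=\|\mathrm{e}^{\omega|s|}v\,g\|_{L^2}<\infty$. Let $\mathrm{W}^2_v(\mathrm{St}_\omega)$ be the algebra (under pointwise multiplication) of all functions $f=\widehat g$, $g\in L^2_{v,\omega}(\mathbb{R})$, on the closed strip $\overline{\mathrm{St}}_\omega=\{z\in\mathbb{C}: |\operatorname{Im}z|\le\omega\}$, where $\widehat g(z)=\int_{\mathbb{R}}\mathrm{e}^{-\mathrm{i}sz}g(s)\,\mathrm{d}s$, with norm $\|\widehat g\|:=\|g\|_{L^2_{v,\omega}}$; for $f=\widehat g$ write $f^\vee:=g$, which is determined by $f$ almost everywhere. The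 operator $A$ is said to have a bounded $\mathrm{W}^2_v(\mathrm{St}_\omega)$-calculus if there is a bounded algebra homomorphism $\Psi:\mathrm{W}^2_v(\mathrm{St}_\omega)\to\mathcal{L}(X)$ such that $\Psi\big((\lambda-z)^{-1}\big)=(\lambda-A)^{-1}$ for some $\lambda\in\mathbb{C}$ with $|\operatorname{Im}\lambda|>\omega$; one then writes $f(A):=\Psi(f)$. Then the following statements are equivalent: (i) For all $x\in X$ and $x'\in X'$ the function $s\mapsto\frac{\mathrm{e}^{-\omega|s|}}{v(s)}\langle U_sx,x'\rangle$ belongs to $L^2(\mathbb{R})$. (ii) $A$ has a bounded $\mathrm{W}^2_v(\mathrm{St}_\omega)$-calculus. In that case, every such $\Psi$ satisfies $\Psi\big((\lambda-z)^{-1}\big)=(\lambda-A)^{-1}$ for all $\lambda\in\mathbb{C}$ with $|\operatorname{Im}\lambda|>\omega$, and $$\langle f(A)x,x'\rangle=\int_{\mathbb{R}}f^\vee(s)\,\langle U_sx,x'\rangle\,\mathrm{d}s$$ for all $f\in \mathrm{W}^2_v(\mathrm{St}_\omega)$, $x\in X$, $x'\in X'$, the integral being absolutely convergent. -/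

import Mathlib

open MeasureTheory
open scoped ENNReal Convolution

namespace SobolevCalculus

/-! ### Weights and weighted `L²`-spaces -/

/-- A measurable function `v : ℝ → [1, ∞)` is strongly admissible if
`sup_{s,t} v (s + t) / (v s + v t) < ∞` and `1 / v ∈ L²(ℝ)`. -/
structure StronglyAdmissible (v : ℝ → ℝ) : Prop where
  measurable : Measurable v
  one_le : ∀ s, 1 ≤ v s
  bddAbove : BddAbove (Set.range fun p : ℝ × ℝ => v (p.1 + p.2) / (v p.1 + v p.2))
  memLp_inv : MemLp (fun s => (v s)⁻¹) 2 volume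

/-- The function `s ↦ exp (ω |s|) v(s) g(s)`. -/
noncomputable def weighted (v : ℝ → ℝ) (ω : ℝ) (g : ℝ → ℂ) (s : ℝ) : ℂ :=
  ((Real.exp (ω * |s|) * v s : ℝ) : ℂ) * g s

/-- `g ∈ L²_{v,ω}(ℝ)`, that is, `g ∈ L²(ℝ)` and `exp (ω |s|) v g ∈ L²(ℝ)`. -/
def MemWeightedL2 (v : ℝ → ℝ) (ω : ℝ) (g : ℝ → ℂ) : Prop :=
  MemLp g 2 volume ∧ MemLp (weighted v ω g) 2 volume

/-- The norm of `L²_{v,ω}(ℝ)`, namely `‖exp (ω |s|) v g‖_{L²}`. -/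
noncomputable def weightedL2Norm (v : ℝ → ℝ) (ω : ℝ) (g : ℝ → ℂ) : ℝ :=
  (eLpNorm (weighted v ω g) 2 volume).toReal

/-! ### The Fourier transform on the closed strip and the Sobolev algebra -/

/-- The closed horizontal strip `{z | |Im z| ≤ ω}` (the real line for `ω = 0`). -/
abbrev ClosedStrip (ω : ℝ) : Type := {z : ℂ // |z.im| ≤ ω}

/-- The Fourier transform `ĝ(z) = ∫ exp (-i s z) g(s) ds` as a function on the closed strip. -/
noncomputable def stripFourier (ω : ℝ) (g : ℝ → ℂ) (z : ClosedStrip ω) : ℂ :=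
  ∫ s : ℝ, Complex.exp (-Complex.I * s * (z : ℂ)) * g s

/-- `g = f^∨` for a function `f` in the Sobolev space, that is,
`g ∈ L²_{v,ω}(ℝ)` and `f = ĝ`. -/
def IsInvFourier (v : ℝ → ℝ) (ω : ℝ) (f : ClosedStrip ω → ℂ) (g : ℝ → ℂ) : Prop :=
  MemWeightedL2 v ω g ∧ f = stripFourier ω g

variable {v : ℝ → ℝ} {ω : ℝ} {g h : ℝ → ℂ}

theorem StronglyAdmissible.pos (hv : StronglyAdmissible v) (s : ℝ) : 0 < v s :=
  lt_of_lt_of_le one_pos (hv.one_le s)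

theorem MemWeightedL2.add (hg : MemWeightedL2 v ω g) (hh : MemWeightedL2 v ω h) :
    MemWeightedL2 v ω (g + h) := by
  refine ⟨hg.1.add hh.1, ?_⟩
  have : weighted v ω (g + h) = weighted v ω g + weighted v ω h := by
    funext s; simp [weighted, mul_add]
  rw [this]; exact hg.2.add hh.2

theorem MemWeightedL2.smul (c : ℂ) (hg : MemWeightedL2 v ω g) :
    MemWeightedL2 v ω (c • g) := by
  refine ⟨hg.1.const_smul c, ?_⟩
  have : weighted v ω (c • g) = c • weighted v ω g := by
    funext s; simp only [weighted, Pi.smul_apply, smul_eq_mul]; ring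
  rw [this]; exact hg.2.const_smul c

theorem memWeightedL2_zero : MemWeightedL2 v ω 0 := by
  refine ⟨MemLp.zero, ?_⟩
  have : weighted v ω 0 = 0 := by funext s; simp [weighted]
  rw [this]; exact MemLp.zero

/-- `exp (ω |s|) g` is integrable for `g ∈ L²_{v,ω}(ℝ)`. -/
theorem MemWeightedL2.integrable_exp (hv : StronglyAdmissible v) (hg : MemWeightedL2 v ω g) :
    Integrable (fun s => ((Real.exp (ω * |s|) : ℝ) : ℂ) * g s) := by
  have h1 : MemLp (fun s => (((v s)⁻¹ : ℝ) : ℂ)) 2 volume := hv.memLp_inv.ofReal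
  have h2 := h1.integrable_mul hg.2
  refine h2.congr (Filter.Eventually.of_forall fun s => ?_)
  have : ((v s : ℝ) : ℂ) ≠ 0 := by exact_mod_cast (hv.pos s).ne'
  simp only [weighted, Pi.mul_apply]
  push_cast
  field_simp

theorem norm_exp_strip (z : ClosedStrip ω) (s : ℝ) :
    ‖Complex.exp (-Complex.I * s * (z : ℂ))‖ ≤ Real.exp (ω * |s|) := by
  rw [Complex.norm_exp]
  refine Real.exp_le_exp.2 ?_
  have : (-Complex.I * s * (z : ℂ)).re = s * (z : ℂ).im := by simp
  rw [this]
  calc s * (z : ℂ).im ≤ |s * (z : ℂ).im| := le_abs_self _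
    _ = |(z : ℂ).im| * |s| := by rw [abs_mul, mul_comm]
    _ ≤ ω * |s| := mul_le_mul_of_nonneg_right z.2 (abs_nonneg s)

/-- The integral defining `ĝ(z)` converges absolutely on the closed strip. -/
theorem MemWeightedL2.integrable_kernel (hv : StronglyAdmissible v) (hg : MemWeightedL2 v ω g)
    (z : ClosedStrip ω) :
    Integrable (fun s : ℝ => Complex.exp (-Complex.I * s * (z : ℂ)) * g s) := by
  refine (hg.integrable_exp hv).mono ?_ (Filter.Eventually.of_forall fun s => ?_)
  · exact (Continuous.aestronglyMeasurable (by fun_prop)).mul hg.1.1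
  · rw [norm_mul, norm_mul, Complex.norm_real, Real.norm_of_nonneg (Real.exp_pos _).le]
    exact mul_le_mul_of_nonneg_right (norm_exp_strip z s) (norm_nonneg _)

/-- The function `g = f^∨` is determined by `f` almost everywhere. -/
theorem IsInvFourier.ae_eq (hv : StronglyAdmissible v) (hω : 0 ≤ ω) {f : ClosedStrip ω → ℂ}
    (hg : IsInvFourier v ω f g) (hh : IsInvFourier v ω f h) : g =ᵐ[volume] h := by
  have hz : ∀ x : ℝ, |((x : ℝ) : ℂ).im| ≤ ω := fun x => by simpa using hω
  have hgi : Integrable g := by simpa using hg.1.integrable_kernel hv ⟨0, by simpa using hω⟩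
  have hhi : Integrable h := by simpa using hh.1.integrable_kernel hv ⟨0, by simpa using hω⟩
  have hki : Integrable (g - h) := hgi.sub hhi
  have hF : ∀ ξ : ℝ, FourierTransform.fourier (g - h) ξ = 0 := by
    intro ξ
    have h1 := congrFun (hg.2.symm.trans hh.2) ⟨((2 * Real.pi * ξ : ℝ) : ℂ), hz _⟩
    simp only [stripFourier] at h1
    rw [← sub_eq_zero, ← integral_sub (hg.1.integrable_kernel hv ⟨_, hz _⟩)
      (hh.1.integrable_kernel hv ⟨_, hz _⟩)] at h1
    rw [Real.fourier_real_eq_integral_exp_smul, ← h1]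
    refine integral_congr_ae (Filter.Eventually.of_forall fun s => ?_)
    simp only [Pi.sub_apply, smul_eq_mul, ← mul_sub]
    congr 2
    push_cast
    ring
  have hae : ∀ᵐ s : ℝ, (g - h) s = 0 := by
    refine ae_eq_zero_of_integral_contDiff_smul_eq_zero hki.locallyIntegrable ?_
    intro ψ hψ hψc
    have hc : HasCompactSupport (fun x => ((ψ x : ℝ) : ℂ)) :=
      hψc.comp_left (g := fun r : ℝ => (r : ℂ)) (by simp)
    let φ : SchwartzMap ℝ ℂ := hc.toSchwartzMap (Complex.ofRealCLM.contDiff.comp hψ)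
    let χ : SchwartzMap ℝ ℂ := FourierTransformInv.fourierInv φ
    have hχ : FourierTransform.fourier χ = φ := FourierTransform.fourier_fourierInv_eq φ
    have key := VectorFourier.integral_bilin_fourierIntegral_eq_flip (ContinuousLinearMap.mul ℂ ℂ)
      (L := innerₗ ℝ) Real.continuous_fourierChar continuous_inner hki (χ.integrable (μ := volume))
    have e1 : ∀ ξ : ℝ, VectorFourier.fourierIntegral Real.fourierChar volume (innerₗ ℝ) (g - h) ξ
        = 0 := hF
    have e2 : ∀ x : ℝ, VectorFourier.fourierIntegral Real.fourierChar volume (innerₗ ℝ).flip χ x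
        = φ x := fun x => by
      rw [flip_innerₗ, ← hχ]; rfl
    simp only [e1, e2, ContinuousLinearMap.mul_apply', zero_mul, integral_zero] at key
    rw [key]
    refine integral_congr_ae (Filter.Eventually.of_forall fun s => ?_)
    change ψ s • (g - h) s = (g - h) s * ((ψ s : ℝ) : ℂ)
    rw [Complex.real_smul, mul_comm]
  filter_upwards [hae] with s hs
  exact sub_eq_zero.1 hs

/-- Young's inequality `‖F * H‖_2 ≤ ‖F‖_1 ‖H‖_2` for non-negative functions, in squared form. -/
theorem lintegral_conv_sq_le {F H : ℝ → ℝ≥0∞} (hF : AEMeasurable F) (hH : AEMeasurable H) :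
    ∫⁻ s, (∫⁻ t, F t * H (s - t)) ^ (2 : ℝ) ≤ (∫⁻ t, F t) ^ (2 : ℝ) * ∫⁻ s, H s ^ (2 : ℝ) := by
  have hHs : ∀ s : ℝ, AEMeasurable (fun t => H (s - t)) := fun s =>
    hH.comp_quasiMeasurePreserving (quasiMeasurePreserving_sub_left volume s)
  have key : ∀ s : ℝ, (∫⁻ t, F t * H (s - t)) ^ (2 : ℝ) ≤
      (∫⁻ t, F t) * ∫⁻ t, F t * H (s - t) ^ (2 : ℝ) := by
    intro s
    have hol := ENNReal.lintegral_mul_le_Lp_mul_Lq volume Real.HolderConjugate.two_two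
      (f := fun t => F t ^ (1 / 2 : ℝ)) (g := fun t => F t ^ (1 / 2 : ℝ) * H (s - t))
      (hF.pow_const _) ((hF.pow_const _).mul (hHs s))
    have hsq : ∀ a : ℝ≥0∞, (a ^ (1 / 2 : ℝ)) ^ (2 : ℝ) = a := fun a => by
      rw [← ENNReal.rpow_mul]; norm_num
    have h1 : ∀ t, ((fun t => F t ^ (1 / 2 : ℝ)) * fun t => F t ^ (1 / 2 : ℝ) * H (s - t)) t
        = F t * H (s - t) := by
      intro t
      have : F t ^ (1 / 2 : ℝ) * F t ^ (1 / 2 : ℝ) = F t := by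
        rw [← ENNReal.rpow_add_of_nonneg _ _ (by norm_num) (by norm_num)]; norm_num
      simp only [Pi.mul_apply]
      rw [← mul_assoc, this]
    simp only [h1, ENNReal.mul_rpow_of_nonneg _ _ (zero_le_two (α := ℝ)), hsq] at hol
    calc (∫⁻ t, F t * H (s - t)) ^ (2 : ℝ)
        ≤ ((∫⁻ t, F t) ^ (1 / 2 : ℝ) *
            (∫⁻ t, F t * H (s - t) ^ (2 : ℝ)) ^ (1 / 2 : ℝ)) ^ (2 : ℝ) :=
          ENNReal.rpow_le_rpow hol zero_le_two
      _ = _ := by rw [ENNReal.mul_rpow_of_nonneg _ _ zero_le_two, hsq, hsq]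
  have hprod : AEMeasurable (fun p : ℝ × ℝ => F p.2 * H (p.1 - p.2) ^ (2 : ℝ))
      (volume.prod volume) :=
    (hF.comp_quasiMeasurePreserving Measure.quasiMeasurePreserving_snd).mul
      ((hH.comp_quasiMeasurePreserving
        (quasiMeasurePreserving_sub_of_right_invariant volume volume)).pow_const _)
  calc ∫⁻ s, (∫⁻ t, F t * H (s - t)) ^ (2 : ℝ)
      ≤ ∫⁻ s, (∫⁻ t, F t) * ∫⁻ t, F t * H (s - t) ^ (2 : ℝ) := lintegral_mono key
    _ = (∫⁻ t, F t) * ∫⁻ s, ∫⁻ t, F t * H (s - t) ^ (2 : ℝ) :=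
        lintegral_const_mul'' _ hprod.lintegral_prod_right'
    _ = (∫⁻ t, F t) * ∫⁻ t, ∫⁻ s, F t * H (s - t) ^ (2 : ℝ) := by
        rw [lintegral_lintegral_swap hprod]
    _ = (∫⁻ t, F t) * ∫⁻ t, F t * ∫⁻ s, H s ^ (2 : ℝ) := by
        congr 1
        refine lintegral_congr fun t => ?_
        have hHt : AEMeasurable (fun s => H (s - t)) := hH.comp_quasiMeasurePreserving
          (measurePreserving_sub_right volume t).quasiMeasurePreserving
        rw [lintegral_const_mul'' _ (hHt.pow_const _), lintegral_sub_right_eq_self (fun s => H s ^ (2 : ℝ)) t]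
    _ = _ := by
        rw [lintegral_mul_const'' _ hF, ← mul_assoc]
        congr 1
        rw [ENNReal.rpow_two, sq]

/-- `L²_{v,ω}(ℝ)` is closed under convolution. -/
theorem MemWeightedL2.convolution (hv : StronglyAdmissible v) (hω : 0 ≤ ω)
    (hg : MemWeightedL2 v ω g) (hh : MemWeightedL2 v ω h) :
    MemWeightedL2 v ω (g ⋆[ContinuousLinearMap.mul ℝ ℂ, volume] h) := by
  have hconvint : AEStronglyMeasurable (g ⋆[ContinuousLinearMap.mul ℝ ℂ, volume] h) volume := by
    have hg0 : Integrable g := by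
      simpa using hg.integrable_kernel hv ⟨0, by simpa using hω⟩
    have hh0 : Integrable h := by
      simpa using hh.integrable_kernel hv ⟨0, by simpa using hω⟩
    exact (hg0.integrable_convolution _ hh0).aestronglyMeasurable
  obtain ⟨M, hM⟩ := hv.bddAbove
  have hM' : ∀ s t, v (s + t) ≤ M * (v s + v t) := fun s t => by
    have := hM (Set.mem_range_self (s, t))
    exact (div_le_iff₀ (add_pos (hv.pos s) (hv.pos t))).1 this
  have hM0 : 0 ≤ M := by
    have h0 := hM' 0 0
    have h1 := hv.pos 0
    have h2 := hv.pos (0 + 0)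
    nlinarith
  let E : ℝ → ℝ := fun s => Real.exp (ω * |s|)
  have hE : ∀ s t, E s ≤ E t * E (s - t) := fun s t => by
    simp only [E]
    rw [← Real.exp_add, ← mul_add]
    refine Real.exp_le_exp.2 (mul_le_mul_of_nonneg_left ?_ hω)
    calc |s| = |t + (s - t)| := by congr 1; ring
      _ ≤ _ := abs_add_le _ _
  have hEpos : ∀ s, 0 < E s := fun s => Real.exp_pos _
  have hwt : ∀ s t, E s * v s ≤ M * (E t * v t * E (s - t) + E t * (E (s - t) * v (s - t))) := by
    intro s t
    have h1 := hM' t (s - t)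
    rw [add_sub_cancel] at h1
    calc E s * v s ≤ (E t * E (s - t)) * (M * (v t + v (s - t))) :=
          mul_le_mul (hE s t) h1 (hv.pos s).le (mul_pos (hEpos _) (hEpos _)).le
      _ = _ := by ring
  -- the four non-negative functions entering the estimate
  let Eg : ℝ → ℝ≥0∞ := fun s => ‖((E s : ℝ) : ℂ) * g s‖ₑ
  let Eh : ℝ → ℝ≥0∞ := fun s => ‖((E s : ℝ) : ℂ) * h s‖ₑ
  let Wg : ℝ → ℝ≥0∞ := fun s => ‖weighted v ω g s‖ₑ
  let Wh : ℝ → ℝ≥0∞ := fun s => ‖weighted v ω h s‖ₑ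
  have iEg := hg.integrable_exp hv
  have iEh := hh.integrable_exp hv
  have mEg : AEMeasurable Eg := iEg.aestronglyMeasurable.enorm
  have mEh : AEMeasurable Eh := iEh.aestronglyMeasurable.enorm
  have mWg : AEMeasurable Wg := hg.2.1.enorm
  have mWh : AEMeasurable Wh := hh.2.1.enorm
  have fEg : ∫⁻ s, Eg s < ⊤ := iEg.2
  have fEh : ∫⁻ s, Eh s < ⊤ := iEh.2
  have fWg : ∫⁻ s, Wg s ^ (2 : ℝ) < ⊤ := by
    simpa using lintegral_rpow_enorm_lt_top_of_eLpNorm_lt_top two_ne_zero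
      ENNReal.ofNat_ne_top hg.2.2
  have fWh : ∫⁻ s, Wh s ^ (2 : ℝ) < ⊤ := by
    simpa using lintegral_rpow_enorm_lt_top_of_eLpNorm_lt_top two_ne_zero
      ENNReal.ofNat_ne_top hh.2.2
  let P : ℝ → ℝ≥0∞ := fun s => ∫⁻ t, Eh t * Wg (s - t)
  let Q : ℝ → ℝ≥0∞ := fun s => ∫⁻ t, Eg t * Wh (s - t)
  have fP : ∫⁻ s, P s ^ (2 : ℝ) < ⊤ := (lintegral_conv_sq_le mEh mWg).trans_lt
    (ENNReal.mul_lt_top (ENNReal.rpow_lt_top_of_nonneg zero_le_two fEh.ne) fWg)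
  have fQ : ∫⁻ s, Q s ^ (2 : ℝ) < ⊤ := (lintegral_conv_sq_le mEg mWh).trans_lt
    (ENNReal.mul_lt_top (ENNReal.rpow_lt_top_of_nonneg zero_le_two fEg.ne) fWh)
  have mQ : AEMeasurable Q := by
    have : AEMeasurable (fun p : ℝ × ℝ => Eg p.2 * Wh (p.1 - p.2)) (volume.prod volume) :=
      (mEg.comp_quasiMeasurePreserving Measure.quasiMeasurePreserving_snd).mul
        (mWh.comp_quasiMeasurePreserving
          (quasiMeasurePreserving_sub_of_right_invariant volume volume))
    exact this.lintegral_prod_right'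
  have hP : ∀ s, P s = ∫⁻ t, Wg t * Eh (s - t) := fun s => by
    simp only [P]
    rw [← lintegral_sub_left_eq_self _ s]
    refine lintegral_congr fun t => ?_
    rw [sub_sub_cancel, mul_comm]
  have hsub : ∀ s : ℝ, Measure.QuasiMeasurePreserving (fun t : ℝ => s - t) volume volume :=
    fun s => quasiMeasurePreserving_sub_left volume s
  have hbound : ∀ s, ‖weighted v ω (g ⋆[ContinuousLinearMap.mul ℝ ℂ, volume] h) s‖ₑ ≤
      ENNReal.ofReal M * (P s + Q s) := by
    intro s
    have hn : ∀ r : ℝ, 0 ≤ r → ‖(r : ℂ)‖ₑ = ENNReal.ofReal r := fun r hr => by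
      rw [← ofReal_norm, Complex.norm_real, Real.norm_of_nonneg hr]
    have hEv : ∀ r, 0 ≤ E r * v r := fun r => (mul_pos (hEpos r) (hv.pos r)).le
    have hpt : ∀ t, ‖((E s * v s : ℝ) : ℂ)‖ₑ * ‖g t * h (s - t)‖ₑ ≤
        ENNReal.ofReal M * (Wg t * Eh (s - t) + Eg t * Wh (s - t)) := by
      intro t
      simp only [Wg, Wh, Eg, Eh, weighted, enorm_mul]
      rw [hn _ (hEv s), hn _ (hEpos t).le, hn _ (hEpos (s - t)).le]
      change _ ≤ ENNReal.ofReal M * (‖((E t * v t : ℝ) : ℂ)‖ₑ * _ * _ +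
        _ * (‖((E (s - t) * v (s - t) : ℝ) : ℂ)‖ₑ * _))
      rw [hn _ (hEv t), hn _ (hEv (s - t))]
      calc ENNReal.ofReal (E s * v s) * (‖g t‖ₑ * ‖h (s - t)‖ₑ)
          ≤ ENNReal.ofReal (M * (E t * v t * E (s - t) + E t * (E (s - t) * v (s - t)))) *
              (‖g t‖ₑ * ‖h (s - t)‖ₑ) :=
            mul_le_mul_left (ENNReal.ofReal_le_ofReal (hwt s t)) _
        _ = _ := by
          rw [ENNReal.ofReal_mul hM0, ENNReal.ofReal_add
            (mul_nonneg (hEv t) (hEpos _).le) (mul_nonneg (hEpos t).le (hEv _)),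
            ENNReal.ofReal_mul (hEv t),
            ENNReal.ofReal_mul (p := E t) (hEpos t).le (q := E (s - t) * v (s - t))]
          ring
    calc ‖weighted v ω (g ⋆[ContinuousLinearMap.mul ℝ ℂ, volume] h) s‖ₑ
        = ‖((E s * v s : ℝ) : ℂ)‖ₑ * ‖∫ t, g t * h (s - t)‖ₑ := by
          simp only [weighted, enorm_mul, convolution_def, ContinuousLinearMap.mul_apply', E]
      _ ≤ ‖((E s * v s : ℝ) : ℂ)‖ₑ * ∫⁻ t, ‖g t * h (s - t)‖ₑ := by
          gcongr; exact enorm_integral_le_lintegral_enorm _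
      _ = ∫⁻ t, ‖((E s * v s : ℝ) : ℂ)‖ₑ * ‖g t * h (s - t)‖ₑ :=
          (lintegral_const_mul' _ _ enorm_ne_top).symm
      _ ≤ ∫⁻ t, ENNReal.ofReal M * (Wg t * Eh (s - t) + Eg t * Wh (s - t)) :=
          lintegral_mono hpt
      _ = ENNReal.ofReal M * (P s + Q s) := by
          have hm : AEMeasurable (fun t => Wg t * Eh (s - t)) :=
            mWg.mul (mEh.comp_quasiMeasurePreserving (hsub s))
          rw [lintegral_const_mul' _ _ ENNReal.ofReal_ne_top, hP s, lintegral_add_left' hm]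
  have hWmeas : AEStronglyMeasurable
      (weighted v ω (g ⋆[ContinuousLinearMap.mul ℝ ℂ, volume] h)) volume := by
    have hvm := hv.measurable
    exact (Measurable.aestronglyMeasurable (by fun_prop)).mul hconvint
  have hW : MemLp (weighted v ω (g ⋆[ContinuousLinearMap.mul ℝ ℂ, volume] h)) 2 volume := by
    refine ⟨hWmeas, (eLpNorm_lt_top_iff_lintegral_rpow_enorm_lt_top two_ne_zero
      ENNReal.ofNat_ne_top).2 ?_⟩
    rw [ENNReal.toReal_ofNat]
    calc ∫⁻ s, ‖weighted v ω (g ⋆[ContinuousLinearMap.mul ℝ ℂ, volume] h) s‖ₑ ^ (2 : ℝ)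
        ≤ ∫⁻ s, ENNReal.ofReal M ^ (2 : ℝ) *
            (2 ^ ((2 : ℝ) - 1) * (P s ^ (2 : ℝ) + Q s ^ (2 : ℝ))) := by
          refine lintegral_mono fun s => ?_
          refine (ENNReal.rpow_le_rpow (hbound s) zero_le_two).trans ?_
          rw [ENNReal.mul_rpow_of_nonneg _ _ zero_le_two]
          gcongr
          exact ENNReal.rpow_add_le_mul_rpow_add_rpow _ _ one_le_two
      _ < ⊤ := by
          rw [lintegral_const_mul' _ _ (ENNReal.rpow_ne_top_of_nonneg zero_le_two
            ENNReal.ofReal_ne_top), lintegral_const_mul' _ _ (ENNReal.rpow_ne_top_of_nonneg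
            (by norm_num) ENNReal.ofNat_ne_top), lintegral_add_right' _ (mQ.pow_const _)]
          exact ENNReal.mul_lt_top (ENNReal.rpow_lt_top_of_nonneg zero_le_two
            ENNReal.ofReal_ne_top) (ENNReal.mul_lt_top (ENNReal.rpow_lt_top_of_nonneg
            (by norm_num) ENNReal.ofNat_ne_top) (ENNReal.add_lt_top.2 ⟨fP, fQ⟩))
  refine ⟨hW.mono hconvint (Filter.Eventually.of_forall fun s => ?_), hW⟩
  have h1 : 1 ≤ E s * v s := by
    have : 1 ≤ E s := Real.one_le_exp (mul_nonneg hω (abs_nonneg s))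
    nlinarith [hv.one_le s]
  rw [weighted, norm_mul, Complex.norm_real, Real.norm_of_nonneg (zero_le_one.trans h1)]
  exact le_mul_of_one_le_left (norm_nonneg _) h1

/-- The Fourier transform on the strip turns convolutions into products. -/
theorem stripFourier_convolution (hv : StronglyAdmissible v)
    (hg : MemWeightedL2 v ω g) (hh : MemWeightedL2 v ω h) :
    stripFourier ω (g ⋆[ContinuousLinearMap.mul ℝ ℂ, volume] h) =
      stripFourier ω g * stripFourier ω h := by
  funext z
  have hint := integral_convolution (ContinuousLinearMap.mul ℝ ℂ) (hg.integrable_kernel hv z)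
    (hh.integrable_kernel hv z)
  simp only [ContinuousLinearMap.mul_apply'] at hint
  simp only [Pi.mul_apply, stripFourier]
  rw [← hint]
  refine integral_congr_ae (Filter.Eventually.of_forall fun s => ?_)
  simp only [convolution_def, ContinuousLinearMap.mul_apply']
  rw [← integral_const_mul]
  refine integral_congr_ae (Filter.Eventually.of_forall fun t => ?_)
  have : Complex.exp (-Complex.I * s * (z : ℂ)) = Complex.exp (-Complex.I * t * (z : ℂ)) *
      Complex.exp (-Complex.I * ((s - t : ℝ) : ℂ) * (z : ℂ)) := by
    rw [← Complex.exp_add]; congr 1; push_cast; ring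
  simp only [this]
  ring

/-- The generalized Sobolev space `W²_v(St_ω) = {ĝ | g ∈ L²_{v,ω}(ℝ)}`, an algebra of functions
on the closed strip with respect to pointwise multiplication. -/
noncomputable def sobolevAlgebra (hv : StronglyAdmissible v) (hω : 0 ≤ ω) :
    NonUnitalSubalgebra ℂ (ClosedStrip ω → ℂ) where
  carrier := {f | ∃ g, IsInvFourier v ω f g}
  zero_mem' := ⟨0, memWeightedL2_zero, by funext z; simp [stripFourier]⟩
  add_mem' := by
    rintro _ _ ⟨a, ha, rfl⟩ ⟨b, hb, rfl⟩
    refine ⟨a + b, ha.add hb, ?_⟩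
    funext z
    simp only [Pi.add_apply, stripFourier, mul_add]
    exact (integral_add (ha.integrable_kernel hv z) (hb.integrable_kernel hv z)).symm
  smul_mem' := by
    rintro c _ ⟨a, ha, rfl⟩
    refine ⟨c • a, ha.smul c, ?_⟩
    funext z
    simp only [Pi.smul_apply, stripFourier, smul_eq_mul]
    rw [← integral_const_mul]
    exact integral_congr_ae (Filter.Eventually.of_forall fun s => by ring)
  mul_mem' := by
    rintro _ _ ⟨a, ha, rfl⟩ ⟨b, hb, rfl⟩
    exact ⟨_, ha.convolution hv hω hb, (stripFourier_convolution hv ha hb).symm⟩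

/-! ### Groups, generators and resolvents -/

section Operators

variable {X : Type*} [NormedAddCommGroup X] [NormedSpace ℂ X]

/-- A `C₀`-group `(U_s)_{s ∈ ℝ}` of bounded operators on `X`. -/
structure C0Group (X : Type*) [NormedAddCommGroup X] [NormedSpace ℂ X] where
  toFun : ℝ → X →L[ℂ] X
  map_zero : toFun 0 = ContinuousLinearMap.id ℂ X
  map_add : ∀ s t, toFun (s + t) = (toFun s).comp (toFun t)
  continuous : ∀ x, Continuous fun s => toFun s x

instance : CoeFun (C0Group X) (fun _ => ℝ → X →L[ℂ] X) := ⟨C0Group.toFun⟩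

/-- The generator of a `C₀`-group: `x` is in its domain iff `s ↦ U_s x` is differentiable at `0`,
and it maps such an `x` to the derivative. -/
noncomputable def C0Group.generator (U : C0Group X) : X →ₗ.[ℂ] X where
  domain :=
    { carrier := {x | DifferentiableAt ℝ (fun s => U s x) 0}
      zero_mem' := by simp
      add_mem' := fun {x y} hx hy => by
        have h : DifferentiableAt ℝ (fun s => U s x + U s y) 0 := DifferentiableAt.add hx hy
        simpa using h
      smul_mem' := fun c x hx => by
        have h : DifferentiableAt ℝ (fun s => c • U s x) 0 := DifferentiableAt.const_smul hx c
        simpa using h }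
  toFun :=
    { toFun := fun x => deriv (fun s => U s (x : X)) 0
      map_add' := fun x y => by
        have h : deriv (fun s => U s (x : X) + U s (y : X)) 0 = _ := deriv_add x.2 y.2
        simpa using h
      map_smul' := fun c x => by
        have h : deriv (fun s => c • U s (x : X)) 0 = _ := deriv_const_smul c x.2
        simpa using h }

/-- `R = R(λ, A) = (λ - A)⁻¹`: the operator `λ - A : dom A → X` is bijective with the bounded
inverse `R`. -/
def IsResolvent (A : X →ₗ.[ℂ] X) (l : ℂ) (R : X →L[ℂ] X) : Prop :=
  (∀ y : A.domain, R (l • (y : X) - A y) = y) ∧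
    ∀ x : X, ∃ y : A.domain, (y : X) = R x ∧ l • (y : X) - A y = x

/-! ### The bounded Sobolev calculus -/

/-- `Ψ(r_λ) = R(λ, A)`, where `r_λ = (λ - z)⁻¹` belongs to `W²_v(St_ω)`. -/
def MapsToResolvent (hv : StronglyAdmissible v) (hω : 0 ≤ ω) (A : X →ₗ.[ℂ] X)
    (Ψ : sobolevAlgebra hv hω →ₙₐ[ℂ] (X →L[ℂ] X)) (l : ℂ) : Prop :=
  ∃ r : sobolevAlgebra hv hω,
    (∀ z : ClosedStrip ω, (r : ClosedStrip ω → ℂ) z = (l - z)⁻¹) ∧ IsResolvent A l (Ψ r)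

/-- `Ψ` is a bounded `W²_v(St_ω)`-calculus for `A`: an algebra homomorphism that is bounded for
the norm `‖ĝ‖ = ‖g‖_{L²_{v,ω}}` and maps `r_λ` to `R(λ, A)` for some `λ` off the closed strip. -/
structure IsBoundedSobolevCalculus (hv : StronglyAdmissible v) (hω : 0 ≤ ω) (A : X →ₗ.[ℂ] X)
    (Ψ : sobolevAlgebra hv hω →ₙₐ[ℂ] (X →L[ℂ] X)) : Prop where
  bounded : ∃ C : ℝ, ∀ (f : sobolevAlgebra hv hω) (g : ℝ → ℂ),
    IsInvFourier v ω (f : ClosedStrip ω → ℂ) g → ‖Ψ f‖ ≤ C * weightedL2Norm v ω g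
  resolvent : ∃ l : ℂ, ω < |l.im| ∧ MapsToResolvent hv hω A Ψ l

/-- `A` has a bounded `W²_v(St_ω)`-calculus. -/
def HasBoundedSobolevCalculus (hv : StronglyAdmissible v) (hω : 0 ≤ ω) (A : X →ₗ.[ℂ] X) : Prop :=
  ∃ Ψ : sobolevAlgebra hv hω →ₙₐ[ℂ] (X →L[ℂ] X), IsBoundedSobolevCalculus hv hω A Ψ

end Operators

end SobolevCalculus

namespace SobolevCalculus

variable {v : ℝ → ℝ} {ω : ℝ} {g h : ℝ → ℂ}

/-! ### Growth of strongly admissible weights -/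

/-! Everything rests on the weak formula $f(A) = \int f^\vee(s)\,U_s\,\mathrm{d}s$.

From (i), Cauchy–Schwarz makes the weak integral converge for every $g \in L^2_{v,\omega}$, but a
priori it defines an operator into the bidual only. Banach–Steinhaus, used twice, bounds $\|T\|$ by
a multiple of $\|g\|_{L^2_{v,\omega}}$ for all $g$ whose weak integral is an operator $T$ on $X$
(`IsOrbitIntegral.exists_norm_le`). If the weighted function is continuous with compact support, the
integral is a Bochner integral, so density and completeness of $\mathcal{L}(X)$ give $T$ for all $g$
(`IsOrbitIntegral.exists_of_memWeightedL2`). Fubini turns convolutions into products, and Laplace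
transforms of orbits are resolvents for $\lambda$ far from the real axis
(`isResolvent_of_apply_eq_integral`).

Conversely, given $\Psi$, the functional $g \mapsto \langle \Psi(\widehat g)x,x'\rangle$ is bounded
on a Hilbert space, so by Riesz it has a density $u$ with $\mathrm{e}^{-\omega|s|}u/v \in L^2$
(`IsBoundedSobolevCalculus.exists_density`). The resolvent identity carries $\Psi(r_\lambda) =
R(\lambda,A)$ from one $\lambda$ to all $\lambda$ off the strip. Hence $u$ and $\langle U_s
x,x'\rangle$ have equal Laplace transforms far out on both half-lines and agree almost everywhere.
This yields (i) and the formula for every such $\Psi$.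

Both directions need $(\lambda - z)^{-1}$ in the algebra, which holds because $v$ grows
subexponentially. -/

theorem StronglyAdmissible.exists_quasi_subadditive (hv : StronglyAdmissible v) :
    ∃ M : ℝ, 0 ≤ M ∧ ∀ s t, v (s + t) ≤ M * (v s + v t) := by
  obtain ⟨M, hM⟩ := hv.bddAbove
  have hM' : ∀ s t, v (s + t) ≤ M * (v s + v t) := fun s t =>
    (div_le_iff₀ (add_pos (hv.pos s) (hv.pos t))).1 (hM (Set.mem_range_self (s, t)))
  refine ⟨M, ?_, hM'⟩
  have h0 := hM' 0 0
  have h1 := hv.pos 0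
  have h2 := hv.pos (0 + 0)
  nlinarith

/-- A strongly admissible weight is bounded on bounded intervals. -/
theorem StronglyAdmissible.exists_le_of_abs_le (hv : StronglyAdmissible v) {K : ℝ} (hK : 0 < K) :
    ∃ C, ∀ s, |s| ≤ K → v s ≤ C := by
  obtain ⟨M, hM0, hM⟩ := hv.exists_quasi_subadditive
  -- The superlevel sets of $v$ shrink to a null set, so some `S n` has measure below $K$. Then `S
  -- n` and $s -$ `S n` cannot cover $[-K,K]$, and a point $t$ outside both has $v(t), v(s-t) \le
  -- n$. The radius $2K$ accommodates $s-t$.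
  let S : ℕ → Set ℝ := fun n => Set.Icc (-(2 * K)) (2 * K) ∩ {t | (n : ℝ) < v t}
  have hmeas : ∀ n, MeasurableSet (S n) := fun n =>
    measurableSet_Icc.inter (measurableSet_lt measurable_const hv.measurable)
  have hanti : Antitone S := fun m n hmn t ht =>
    ⟨ht.1, (Nat.cast_le.2 hmn).trans_lt (show (n : ℝ) < v t from ht.2)⟩
  have hempty : ⋂ n, S n = ∅ := by
    refine Set.eq_empty_iff_forall_notMem.2 fun t ht => ?_
    obtain ⟨n, hn⟩ := exists_nat_ge (v t)
    exact absurd (Set.mem_iInter.1 ht n).2 (not_lt.2 hn)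
  have hfin : volume (S 0) ≠ ⊤ :=
    ((measure_mono Set.inter_subset_left).trans_lt measure_Icc_lt_top).ne
  have hlim := tendsto_measure_iInter_atTop (fun n => (hmeas n).nullMeasurableSet) hanti ⟨0, hfin⟩
  rw [hempty, measure_empty] at hlim
  obtain ⟨n, hn⟩ := (hlim.eventually_lt_const (ENNReal.ofReal_pos.2 hK)).exists
  refine ⟨M * (n + n), fun s hs => ?_⟩
  by_contra hcon
  have hs' := abs_le.1 hs
  have hsub : Set.Icc (-K) K ⊆ S n ∪ (fun t => s - t) ⁻¹' S n := by
    intro t ht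
    by_contra hnot
    simp only [Set.mem_union, not_or, Set.mem_preimage, S, Set.mem_inter_iff, Set.mem_Icc,
      Set.mem_ofPred_eq, not_and, not_lt] at hnot
    have h1 := hnot.1 ⟨by linarith [ht.1], by linarith [ht.2]⟩
    have h2 := hnot.2 ⟨by linarith [ht.2], by linarith [ht.1]⟩
    have h3 := hM t (s - t)
    rw [add_sub_cancel] at h3
    exact hcon (h3.trans (by gcongr))
  have hpre : volume ((fun t => s - t) ⁻¹' S n) = volume (S n) :=
    (Measure.measurePreserving_sub_left volume s).measure_preimage (hmeas n).nullMeasurableSet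
  have hle := (measure_mono hsub).trans (measure_union_le (μ := volume) _ _)
  rw [hpre, Real.volume_Icc] at hle
  have hlt : volume (S n) + volume (S n) < ENNReal.ofReal K + ENNReal.ofReal K :=
    ENNReal.add_lt_add hn hn
  rw [← ENNReal.ofReal_add hK.le hK.le] at hlt
  refine absurd hle (not_le.2 (hlt.trans_le ?_))
  rw [sub_neg_eq_add]

/-- A strongly admissible weight grows slower than any exponential. -/
theorem StronglyAdmissible.exists_le_exp (hv : StronglyAdmissible v) {ε : ℝ} (hε : 0 < ε) :
    ∃ C, 0 < C ∧ ∀ s, v s ≤ C * Real.exp (ε * |s|) := by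
  obtain ⟨M, hM0, hM⟩ := hv.exists_quasi_subadditive
  -- Halving $s$ costs a factor $2M$. For $|s| \ge 2\rho$ this is absorbed by
  -- $\mathrm{e}^{\varepsilon|s|/2}$, so dyadic induction keeps the same constant `C`.
  obtain ⟨ρ, hρ1, hρ⟩ : ∃ ρ : ℝ, 1 ≤ ρ ∧ 2 * M ≤ Real.exp (ε * ρ) := by
    refine ⟨max 1 (2 * M / ε), le_max_left _ _, ?_⟩
    have h1 : 2 * M ≤ ε * max 1 (2 * M / ε) := by
      rw [← div_le_iff₀' hε]; exact le_max_right _ _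
    linarith [Real.add_one_le_exp (ε * max 1 (2 * M / ε))]
  obtain ⟨C, hC⟩ := hv.exists_le_of_abs_le (K := 2 * ρ) (by linarith)
  have hC0 : 0 < C := (hv.pos 0).trans_le (hC 0 (by simpa using by linarith))
  refine ⟨C, hC0, ?_⟩
  have key : ∀ (n : ℕ) (s : ℝ), |s| ≤ 2 ^ n * (2 * ρ) → v s ≤ C * Real.exp (ε * |s|) := by
    intro n
    induction n with
    | zero =>
      intro s hs
      have h1 : 1 ≤ Real.exp (ε * |s|) := Real.one_le_exp (by positivity)
      have := hC s (by simpa using hs)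
      nlinarith
    | succ n ih =>
      intro s hs
      have hhalf : |s / 2| = |s| / 2 := by rw [abs_div, abs_two]
      rcases le_total |s| (2 * ρ) with h | h
      · have h1 : 1 ≤ Real.exp (ε * |s|) := Real.one_le_exp (by positivity)
        have := hC s h
        nlinarith
      · have h1 := ih (s / 2) (by rw [hhalf]; rw [pow_succ] at hs; linarith)
        have h2 := hM (s / 2) (s / 2)
        rw [add_halves] at h2
        rw [hhalf] at h1
        have h3 : 2 * M ≤ Real.exp (ε * (|s| / 2)) :=
          hρ.trans (Real.exp_le_exp.2 (mul_le_mul_of_nonneg_left (by linarith) hε.le))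
        calc v s ≤ 2 * M * v (s / 2) := by linarith
          _ ≤ Real.exp (ε * (|s| / 2)) * (C * Real.exp (ε * (|s| / 2))) :=
              mul_le_mul h3 h1 (hv.pos _).le (Real.exp_pos _).le
          _ = C * Real.exp (ε * |s|) := by
              rw [mul_left_comm, ← Real.exp_add]; congr 2; ring
  intro s
  obtain ⟨n, hn⟩ := pow_unbounded_of_one_lt |s| one_lt_two
  exact key n s (hn.le.trans (le_mul_of_one_le_right (by positivity) (by linarith)))

theorem integrable_exp_neg_mul_abs {ε : ℝ} (hε : 0 < ε) :
    Integrable fun s : ℝ => Real.exp (-ε * |s|) := by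
  have h1 : IntegrableOn (fun s : ℝ => Real.exp (-ε * |s|)) (Set.Ioi 0) :=
    (exp_neg_integrableOn_Ioi 0 hε).congr_fun (fun s hs => by
      simp [abs_of_pos (Set.mem_Ioi.1 hs)]) measurableSet_Ioi
  have h2 : IntegrableOn (fun s : ℝ => Real.exp (-ε * |s|)) (Set.Iic 0) := by
    rw [← integrableOn_Ici_iff_integrableOn_Ioi] at h1
    simpa using h1.comp_neg
  rw [← integrableOn_univ, ← Set.Iic_union_Ioi (a := (0 : ℝ))]
  exact h2.union h1

/-- `exp (-ε |s|) v` is square integrable for a strongly admissible weight `v`. -/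
theorem StronglyAdmissible.memLp_exp_mul (hv : StronglyAdmissible v) {ε : ℝ} (hε : 0 < ε) :
    MemLp (fun s => Real.exp (-ε * |s|) * v s) 2 volume := by
  obtain ⟨C, hC0, hC⟩ := hv.exists_le_exp (half_pos hε)
  have hm : Measurable fun s => Real.exp (-ε * |s|) * v s := by
    have := hv.measurable; fun_prop
  rw [memLp_two_iff_integrable_sq hm.aestronglyMeasurable]
  refine ((integrable_exp_neg_mul_abs hε).const_mul (C ^ 2)).mono'
    (hm.pow_const 2).aestronglyMeasurable (Filter.Eventually.of_forall fun s => ?_)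
  rw [Real.norm_of_nonneg (by positivity), mul_pow]
  calc Real.exp (-ε * |s|) ^ 2 * v s ^ 2
      ≤ Real.exp (-ε * |s|) ^ 2 * (C * Real.exp (ε / 2 * |s|)) ^ 2 := by
        gcongr
        · exact (hv.pos s).le
        · exact hC s
    _ = C ^ 2 * Real.exp (-ε * |s|) := by
        rw [mul_pow, ← Real.exp_nat_mul, ← Real.exp_nat_mul, mul_left_comm, ← Real.exp_add]
        congr 2; push_cast; ring

/-! ### The inverse Fourier transform of `(l - z)⁻¹` -/

/-- The function `1_{σ s > 0} (-i σ) exp (i s l)` for `σ = ± 1`. -/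
noncomputable def resolventKernel (σ : ℝ) (l : ℂ) (s : ℝ) : ℂ :=
  (Set.Ioi (0 : ℝ)).indicator
    (fun t : ℝ => -Complex.I * σ * Complex.exp (Complex.I * σ * l * t)) (σ * s)

variable {σ : ℝ} {l : ℂ}

theorem measurable_resolventKernel : Measurable (resolventKernel σ l) := by
  refine Measurable.comp (Measurable.indicator ?_ measurableSet_Ioi) (measurable_const_mul σ)
  fun_prop

theorem norm_resolventKernel_le (hσ : |σ| = 1) (s : ℝ) :
    ‖resolventKernel σ l s‖ ≤ Real.exp (-(σ * l.im) * |s|) := by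
  unfold resolventKernel
  by_cases hs : σ * s ∈ Set.Ioi (0 : ℝ)
  · rw [Set.indicator_of_mem hs, norm_mul, norm_mul, norm_neg, Complex.norm_I, Complex.norm_real,
      Real.norm_eq_abs, hσ, Complex.norm_exp, one_mul, one_mul]
    have : |s| = σ * s := by
      rw [← abs_of_pos (Set.mem_Ioi.1 hs), abs_mul, hσ, one_mul]
    rw [this]
    refine Real.exp_le_exp.2 (le_of_eq ?_)
    simp
  · rw [Set.indicator_of_notMem hs, norm_zero]
    exact (Real.exp_pos _).le

/-- The strict gap $\sigma\operatorname{Im} l - \omega > 0$ leaves exponential decay that beats the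
subexponential weight. -/
theorem memWeightedL2_resolventKernel (hv : StronglyAdmissible v) (hω : 0 ≤ ω) (hσ : |σ| = 1)
    (hl : ω < σ * l.im) : MemWeightedL2 v ω (resolventKernel σ l) := by
  have hm : Measurable (weighted v ω (resolventKernel σ l)) := by
    have := hv.measurable
    have := measurable_resolventKernel (σ := σ) (l := l)
    unfold weighted; fun_prop
  have hW : MemLp (weighted v ω (resolventKernel σ l)) 2 volume := by
    refine (hv.memLp_exp_mul (sub_pos.2 hl)).mono hm.aestronglyMeasurable
      (Filter.Eventually.of_forall fun s => ?_)
    have hvs := hv.pos s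
    rw [weighted, norm_mul, Complex.norm_real, Real.norm_of_nonneg (by positivity),
      Real.norm_of_nonneg (by positivity)]
    refine (mul_le_mul_of_nonneg_left (norm_resolventKernel_le hσ s) (by positivity)).trans_eq ?_
    rw [mul_right_comm, ← Real.exp_add]
    congr 2; ring
  refine ⟨hW.mono measurable_resolventKernel.aestronglyMeasurable
    (Filter.Eventually.of_forall fun s => ?_), hW⟩
  have h1 : 1 ≤ Real.exp (ω * |s|) * v s := by
    have : 1 ≤ Real.exp (ω * |s|) := Real.one_le_exp (mul_nonneg hω (abs_nonneg s))
    nlinarith [hv.one_le s]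
  rw [weighted, norm_mul, Complex.norm_real, Real.norm_of_nonneg (zero_le_one.trans h1)]
  exact le_mul_of_one_le_left (norm_nonneg _) h1

/-- Since $\sigma^2 = 1$, the substitution $s = \sigma t$ moves either half-line to $t > 0$, so both
signs are treated at once. -/
theorem resolventKernel_smul_eq_indicator {E : Type*} [NormedAddCommGroup E] [NormedSpace ℂ E]
    (hσ : |σ| = 1) (F : ℝ → E) (t : ℝ) :
    resolventKernel σ l (σ * t) • F (σ * t) = (Set.Ioi (0 : ℝ)).indicator
      (fun t : ℝ => (-Complex.I * σ) • Complex.exp (Complex.I * σ * l * t) • F (σ * t)) t := by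
  have hσσ : σ * (σ * t) = t := by
    rw [← mul_assoc, ← abs_mul_abs_self, hσ, one_mul, one_mul]
  rw [resolventKernel, hσσ]
  by_cases ht : t ∈ Set.Ioi (0 : ℝ)
  · simp only [Set.indicator_of_mem ht, smul_smul]
  · simp only [Set.indicator_of_notMem ht, zero_smul]

theorem integral_resolventKernel_smul {E : Type*} [NormedAddCommGroup E] [NormedSpace ℂ E]
    (hσ : |σ| = 1) (F : ℝ → E) :
    ∫ s, resolventKernel σ l s • F s = (-Complex.I * σ) •
      ∫ t in Set.Ioi (0 : ℝ), Complex.exp (Complex.I * σ * l * t) • F (σ * t) := by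
  have h := Measure.integral_comp_mul_left (fun s => resolventKernel σ l s • F s) σ
  rw [abs_inv, hσ, inv_one, one_smul] at h
  rw [← h, ← integral_smul, ← integral_indicator measurableSet_Ioi]
  exact integral_congr_ae (Filter.Eventually.of_forall (resolventKernel_smul_eq_indicator hσ F))

theorem integrableOn_Ioi_of_resolventKernel_smul {E : Type*} [NormedAddCommGroup E]
    [NormedSpace ℂ E] (hσ : |σ| = 1) {F : ℝ → E}
    (hF : Integrable fun s => resolventKernel σ l s • F s) :
    IntegrableOn (fun t : ℝ => Complex.exp (Complex.I * σ * l * t) • F (σ * t)) (Set.Ioi 0) := by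
  have hσ0 : σ ≠ 0 := by rintro rfl; simp at hσ
  have h := (integrable_comp_mul_left_iff (fun s => resolventKernel σ l s • F s) hσ0).2 hF
  rw [integrable_congr (Filter.Eventually.of_forall (resolventKernel_smul_eq_indicator hσ F)),
    integrable_indicator_iff measurableSet_Ioi] at h
  exact (integrable_smul_iff (by simp [hσ0]) _).1 h

/-- The transform reduces to $\int_0^\infty \mathrm{e}^{\mathrm{i}\sigma(l-z)t}\,\mathrm{d}t$, which
converges because $\sigma\operatorname{Im} z \le \omega < \sigma\operatorname{Im} l$. -/
theorem stripFourier_resolventKernel (hσ : |σ| = 1) (hl : ω < σ * l.im)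
    (z : ClosedStrip ω) : stripFourier ω (resolventKernel σ l) z = (l - z)⁻¹ := by
  have hσσ : (σ : ℂ) * σ = 1 := by
    rw [← Complex.ofReal_mul, ← abs_mul_abs_self, hσ]; simp
  have hσz : σ * (z : ℂ).im ≤ ω :=
    (le_abs_self _).trans (by rw [abs_mul, hσ, one_mul]; exact z.2)
  have h1 : stripFourier ω (resolventKernel σ l) z =
      ∫ s, resolventKernel σ l s • Complex.exp (-Complex.I * s * (z : ℂ)) :=
    integral_congr_ae (Filter.Eventually.of_forall fun s => by simp [mul_comm])
  have hre : (Complex.I * σ * (l - z)).re < 0 := by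
    simp only [Complex.mul_re, Complex.mul_im, Complex.I_re, Complex.I_im, Complex.ofReal_re,
      Complex.ofReal_im, Complex.sub_re, Complex.sub_im]
    linarith
  have hne : l - z ≠ 0 := by
    intro h; simp [h] at hre
  have hσ0 : (σ : ℂ) ≠ 0 := left_ne_zero_of_mul_eq_one hσσ
  rw [h1, integral_resolventKernel_smul hσ]
  have h2 : ∀ t : ℝ, Complex.exp (Complex.I * σ * l * t) •
      Complex.exp (-Complex.I * ((σ * t : ℝ) : ℂ) * z) =
      Complex.exp (Complex.I * σ * (l - z) * t) := fun t => by
    rw [smul_eq_mul, ← Complex.exp_add]; congr 1; push_cast; ring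
  simp only [h2]
  rw [integral_exp_mul_complex_Ioi hre]
  simp only [Complex.ofReal_zero, mul_zero, Complex.exp_zero, smul_eq_mul]
  field_simp

/-- Modulating the kernel shifts the parameter along the real axis. -/
theorem exp_mul_resolventKernel (hσ : |σ| = 1) (x s : ℝ) :
    Complex.exp (-Complex.I * s * x) * resolventKernel σ l s = resolventKernel σ (l - x) s := by
  have hσσ : (σ : ℂ) * σ = 1 := by
    rw [← Complex.ofReal_mul, ← abs_mul_abs_self, hσ]; simp
  unfold resolventKernel
  by_cases hs : σ * s ∈ Set.Ioi (0 : ℝ)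
  · simp only [Set.indicator_of_mem hs]
    rw [mul_left_comm, ← Complex.exp_add]
    congr 2
    push_cast
    linear_combination (Complex.I * s * x) * hσσ
  · simp only [Set.indicator_of_notMem hs, mul_zero]

theorem resolventKernel_ne_zero {s : ℝ} (hs : 0 < σ * s) : resolventKernel σ l s ≠ 0 := by
  rw [resolventKernel, Set.indicator_of_mem (Set.mem_Ioi.2 hs)]
  have : σ ≠ 0 := by rintro rfl; simp at hs
  simp [this]

/-- For `l` off the closed strip there is a sign `σ` with `σ Im l > ω`. -/
theorem exists_sign_of_lt_abs_im (hl : ω < |l.im|) : ∃ σ : ℝ, |σ| = 1 ∧ ω < σ * l.im := by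
  rcases abs_cases l.im with h | h
  · exact ⟨1, by simp, by linarith⟩
  · exact ⟨-1, by simp, by linarith⟩

theorem isInvFourier_resolventKernel (hv : StronglyAdmissible v) (hω : 0 ≤ ω) (hσ : |σ| = 1)
    (hl : ω < σ * l.im) :
    IsInvFourier v ω (fun z : ClosedStrip ω => (l - z)⁻¹) (resolventKernel σ l) :=
  ⟨memWeightedL2_resolventKernel hv hω hσ hl,
    funext fun z => (stripFourier_resolventKernel hσ hl z).symm⟩

/-! ### Growth of `C₀`-groups and Laplace transforms of orbits -/

section Groups

variable {X : Type*} [NormedAddCommGroup X] [NormedSpace ℂ X] {U : C0Group X} {A : X →ₗ.[ℂ] X}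
  {σ : ℝ} {l : ℂ}

theorem C0Group.apply_add (U : C0Group X) (s t : ℝ) (x : X) : U (s + t) x = U s (U t x) := by
  rw [U.map_add]; rfl

theorem C0Group.apply_zero (U : C0Group X) (x : X) : U 0 x = x := by
  rw [U.map_zero]; rfl

/-- A `C₀`-group is exponentially bounded. -/
theorem C0Group.exists_norm_le_exp [CompleteSpace X] (U : C0Group X) :
    ∃ C a : ℝ, ∀ s, ‖U s‖ ≤ C * Real.exp (a * |s|) := by
  obtain ⟨M, hM⟩ := banach_steinhaus (g := fun s : Set.Icc (-1 : ℝ) 1 => U s) fun x => by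
    obtain ⟨C, hC⟩ := isCompact_Icc.exists_bound_of_continuousOn (s := Set.Icc (-1 : ℝ) 1)
      (U.continuous x).continuousOn
    exact ⟨C, fun s => hC s s.2⟩
  have hM1 : ∀ s : ℝ, |s| ≤ 1 → ‖U s‖ ≤ max M 1 := fun s hs =>
    (hM ⟨s, abs_le.1 hs⟩).trans (le_max_left _ _)
  have hK : 1 ≤ max M 1 := le_max_right _ _
  set K := max M 1
  -- In the inductive step, $s$ is split in the ratio $(n+1):1$, so the second piece lies in
  -- $[-1,1]$.
  have key : ∀ (n : ℕ) (s : ℝ), |s| ≤ n + 1 → ‖U s‖ ≤ K ^ (n + 1) := by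
    intro n
    induction n with
    | zero => intro s hs; simpa using hM1 s (by simpa using hs)
    | succ n ih =>
      intro s hs
      have hn : (0 : ℝ) < n + 2 := by positivity
      push_cast at hs
      have h1 : |s * (n + 1) / (n + 2)| ≤ n + 1 := by
        rw [abs_div, abs_mul, abs_of_pos hn, abs_of_nonneg (by positivity : (0 : ℝ) ≤ n + 1),
          div_le_iff₀ hn]
        nlinarith
      have h2 : |s / (n + 2)| ≤ 1 := by
        rw [abs_div, abs_of_pos hn, div_le_iff₀ hn]; linarith
      have h3 : s = s * (n + 1) / (n + 2) + s / (n + 2) := by field_simp; ring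
      rw [h3, U.map_add, pow_succ K (n + 1)]
      exact (ContinuousLinearMap.opNorm_comp_le _ _).trans
        (mul_le_mul (ih _ h1) (hM1 _ h2) (norm_nonneg _) (by positivity))
  refine ⟨K, Real.log K, fun s => ?_⟩
  have h1 := key ⌊|s|⌋₊ s (Nat.lt_floor_add_one _).le
  refine h1.trans ?_
  have hK0 : 0 < K := by linarith
  rw [← Real.rpow_def_of_pos hK0, pow_succ', ← Real.rpow_natCast]
  gcongr
  exact Nat.floor_le (abs_nonneg s)

/-- Integrability of weighted orbits for an exponentially bounded group. -/
theorem integrable_resolventKernel_smul {E : Type*} [NormedAddCommGroup E] [NormedSpace ℂ E]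
    {C a : ℝ} (hσ : |σ| = 1) (hl : a < σ * l.im) {F : ℝ → E} (hF : Continuous F)
    (hFC : ∀ s, ‖F s‖ ≤ C * Real.exp (a * |s|)) :
    Integrable fun s => resolventKernel σ l s • F s := by
  refine ((integrable_exp_neg_mul_abs (sub_pos.2 hl)).const_mul C).mono'
    (measurable_resolventKernel.aestronglyMeasurable.smul hF.aestronglyMeasurable)
    (Filter.Eventually.of_forall fun s => ?_)
  rw [norm_smul]
  calc ‖resolventKernel σ l s‖ * ‖F s‖
      ≤ Real.exp (-(σ * l.im) * |s|) * (C * Real.exp (a * |s|)) :=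
        mul_le_mul (norm_resolventKernel_le hσ s) (hFC s) (norm_nonneg _) (Real.exp_pos _).le
    _ = C * Real.exp (-(σ * l.im - a) * |s|) := by
        rw [mul_left_comm, ← Real.exp_add]; congr 2; ring

theorem C0Group.integrable_resolventKernel_smul {C a : ℝ}
    (hU : ∀ s, ‖U s‖ ≤ C * Real.exp (a * |s|)) (hσ : |σ| = 1) (hl : a < σ * l.im) (x : X) :
    Integrable fun s => resolventKernel σ l s • U s x := by
  refine SobolevCalculus.integrable_resolventKernel_smul (C := C * ‖x‖) hσ hl (U.continuous x)
    fun s => ?_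
  rw [mul_right_comm]
  exact (U s).le_of_opNorm_le (hU s) x

theorem hasDerivAt_orbit_zero (hA : (-Complex.I) • A = U.generator) (y : A.domain) :
    HasDerivAt (fun s => U s (y : X)) (-Complex.I • A y) 0 := by
  have hdom : A.domain = U.generator.domain := by rw [← hA]; rfl
  have hy : (y : X) ∈ U.generator.domain := hdom ▸ y.2
  have hval : (-Complex.I • A) y = U.generator ⟨y, hy⟩ := by
    -- The operator is generalised to a variable `B` because the membership proof depends on its
    -- domain.
    have : ∀ B : X →ₗ.[ℂ] X, (-Complex.I) • A = B → ∀ hb : (y : X) ∈ B.domain,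
        (-Complex.I • A) y = B ⟨y, hb⟩ := by rintro _ rfl hb; rfl
    exact this _ hA hy
  rw [LinearPMap.smul_apply] at hval
  rw [hval]
  exact DifferentiableAt.hasDerivAt hy

theorem exists_of_hasDerivAt_orbit_zero (hA : (-Complex.I) • A = U.generator) {x w : X}
    (h : HasDerivAt (fun s => U s x) w 0) :
    ∃ y : A.domain, (y : X) = x ∧ A y = Complex.I • w := by
  have hdom : A.domain = U.generator.domain := by rw [← hA]; rfl
  have hx : x ∈ A.domain := by rw [hdom]; exact h.differentiableAt
  refine ⟨⟨x, hx⟩, rfl, ?_⟩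
  have h1 := (hasDerivAt_orbit_zero hA ⟨x, hx⟩).unique h
  rw [← h1, smul_smul]
  simp

/-- The group law $U_t y = U_s U_{t-s} y$ transports the derivative from $0$ to $s$. -/
theorem hasDerivAt_orbit (hA : (-Complex.I) • A = U.generator) (y : A.domain) (s : ℝ) :
    HasDerivAt (fun s => U s (y : X)) (-Complex.I • U s (A y)) s := by
  have h0 : HasDerivAt (fun t => U t (y : X)) (-Complex.I • A y) (s - s) := by
    rw [sub_self]; exact hasDerivAt_orbit_zero hA y
  have h1 : HasDerivAt (fun t => U (t - s) (y : X)) (-Complex.I • A y) s := by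
    simpa using h0.comp_sub_const s s
  have h2 := ((U s).restrictScalars ℝ).hasFDerivAt.comp_hasDerivAt s h1
  have h3 : (((U s).restrictScalars ℝ) ∘ fun t => U (t - s) (y : X)) = fun t => U t (y : X) := by
    funext t
    change U s (U (t - s) (y : X)) = _
    rw [← U.apply_add, add_sub_cancel]
  rw [h3] at h2
  simpa using h2

variable [CompleteSpace X]

/-- Laplace transforms of orbits are left inverses of `l - A`. -/
theorem integral_resolventKernel_smul_sub (hA : (-Complex.I) • A = U.generator) {C a : ℝ}
    (hU : ∀ s, ‖U s‖ ≤ C * Real.exp (a * |s|)) (hσ : |σ| = 1) (hl : a < σ * l.im)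
    (y : A.domain) :
    ∫ s, resolventKernel σ l s • U s (l • (y : X) - A y) = y := by
  have hint := integrableOn_Ioi_of_resolventKernel_smul hσ
    (C0Group.integrable_resolventKernel_smul hU hσ hl (l • (y : X) - A y))
  -- The integrand, up to the factor $\mathrm{i}\sigma$, is the derivative of
  -- $\mathrm{e}^{\mathrm{i}\sigma l t}U_{\sigma t}y$, which runs from $y$ at $0$ to $0$ at
  -- infinity.
  have hder : ∀ t ∈ Set.Ici (0 : ℝ), HasDerivAt
      (fun t : ℝ => Complex.exp (Complex.I * σ * l * t) • U (σ * t) (y : X))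
      ((Complex.I * σ) • Complex.exp (Complex.I * σ * l * t) • U (σ * t) (l • (y : X) - A y))
      t := by
    intro t _
    have h1 : HasDerivAt (fun t : ℝ => Complex.exp (Complex.I * σ * l * t))
        (Complex.exp (Complex.I * σ * l * t) * (Complex.I * σ * l)) t := by
      have := ((hasDerivAt_id (t : ℂ)).const_mul (Complex.I * σ * l)).cexp.comp_ofReal
      simpa using this
    have h2 : HasDerivAt (fun t : ℝ => U (σ * t) (y : X))
        (σ • (-Complex.I • U (σ * t) (A y))) t := by
      have h3 : HasDerivAt (fun t : ℝ => σ * t) σ t := by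
        simpa using (hasDerivAt_id t).const_mul σ
      exact (hasDerivAt_orbit hA y (σ * t)).scomp t h3
    refine (h1.smul h2).congr_deriv (Eq.symm ?_)
    rw [← Complex.coe_smul σ]
    rw [map_sub, map_smul]
    module
  have hbound : Filter.Tendsto
      (fun t : ℝ => Complex.exp (Complex.I * σ * l * t) • U (σ * t) (y : X))
      Filter.atTop (nhds 0) := by
    have h1 : Filter.Tendsto (fun t : ℝ => C * ‖(y : X)‖ * Real.exp (-((σ * l.im - a) * t)))
        Filter.atTop (nhds (C * ‖(y : X)‖ * 0)) :=
      (Real.tendsto_exp_neg_atTop_nhds_zero.comp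
        (Filter.tendsto_id.const_mul_atTop (sub_pos.2 hl))).const_mul _
    rw [mul_zero] at h1
    refine squeeze_zero_norm' ?_ h1
    filter_upwards [Filter.eventually_ge_atTop 0] with t ht
    rw [norm_smul, Complex.norm_exp]
    have h2 : (Complex.I * σ * l * t).re = -(σ * l.im * t) := by simp
    have h3 : |σ * t| = t := by rw [abs_mul, hσ, one_mul, abs_of_nonneg ht]
    have h4 := (U (σ * t)).le_of_opNorm_le (hU _) (y : X)
    rw [h3] at h4
    rw [h2]
    calc _ ≤ Real.exp (-(σ * l.im * t)) * (C * Real.exp (a * t) * ‖(y : X)‖) := by gcongr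
      _ = C * ‖(y : X)‖ * (Real.exp (-(σ * l.im * t)) * Real.exp (a * t)) := by ring
      _ = _ := by rw [← Real.exp_add]; congr 2; ring
  have key := integral_Ioi_of_hasDerivAt_of_tendsto' hder (hint.smul (Complex.I * (σ : ℂ))) hbound
  rw [integral_smul] at key
  rw [integral_resolventKernel_smul hσ, neg_mul, neg_smul, key]
  simp [U.apply_zero]

/-- Every $x$ has the form $(l-A)y$ with $y = Rx$, so the left-inverse identity already identifies
the Laplace transform with $R$. -/
theorem IsResolvent.apply_eq_integral (hA : (-Complex.I) • A = U.generator) {C a : ℝ}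
    (hU : ∀ s, ‖U s‖ ≤ C * Real.exp (a * |s|)) (hσ : |σ| = 1) (hl : a < σ * l.im)
    {R : X →L[ℂ] X} (hR : IsResolvent A l R) (x : X) :
    R x = ∫ s, resolventKernel σ l s • U s x := by
  obtain ⟨y, hy, hyx⟩ := hR.2 x
  rw [← hy, ← integral_resolventKernel_smul_sub hA hU hσ hl y, hyx]

/-- The group acts on the Laplace integral by a scalar factor and a shift of the lower limit. The
result is visibly differentiable in $\tau$, although $x$ itself need not lie in the domain. -/
theorem C0Group.apply_integral_Ioi (U : C0Group X) {φ : ℝ → X} (hφ : Continuous φ)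
    (hint : IntegrableOn φ (Set.Ioi 0)) {c : ℂ}
    (hshift : ∀ t τ : ℝ, U (σ * τ) (φ t) = Complex.exp (-c * τ) • φ (t + τ)) (τ : ℝ) :
    U (σ * τ) (∫ t in Set.Ioi 0, φ t) =
      Complex.exp (-c * τ) • ((∫ t in Set.Ioi 0, φ t) - ∫ t in (0 : ℝ)..τ, φ t) := by
  have hτ : IntegrableOn φ (Set.Ioi τ) := by
    refine ((hφ.integrableOn_Icc (a := τ) (b := 0)).union hint).mono_set fun t ht => ?_
    rcases le_or_gt t 0 with h | h
    · exact Or.inl ⟨ht.le, h⟩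
    · exact Or.inr h
  have h1 := intervalIntegral.integral_interval_add_Ioi' (hφ.intervalIntegrable 0 τ) hτ
  have h2 : ∫ t in Set.Ioi 0, φ (t + τ) = ∫ t in Set.Ioi τ, φ t := by
    rw [← integral_indicator measurableSet_Ioi, ← integral_indicator measurableSet_Ioi,
      ← integral_add_right_eq_self ((Set.Ioi τ).indicator φ) τ]
    refine integral_congr_ae (Filter.Eventually.of_forall fun t => ?_)
    simp only [Set.indicator, Set.mem_Ioi, lt_add_iff_pos_left]
  rw [← ContinuousLinearMap.integral_comp_comm _ hint]
  simp only [hshift]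
  rw [integral_smul, h2, ← h1, add_sub_cancel_left]

/-- The Laplace transform of the orbits is the resolvent. -/
theorem isResolvent_of_apply_eq_integral (hA : (-Complex.I) • A = U.generator) {C a : ℝ}
    (hU : ∀ s, ‖U s‖ ≤ C * Real.exp (a * |s|)) (hσ : |σ| = 1) (hl : a < σ * l.im)
    {R : X →L[ℂ] X} (hR : ∀ x, R x = ∫ s, resolventKernel σ l s • U s x) :
    IsResolvent A l R := by
  have hσσ : (σ : ℂ) * σ = 1 := by
    rw [← Complex.ofReal_mul, ← abs_mul_abs_self, hσ]; simp
  have hσσ' : σ * σ = 1 := by exact_mod_cast hσσ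
  refine ⟨fun y => by rw [hR, integral_resolventKernel_smul_sub hA hU hσ hl], fun x => ?_⟩
  let φ : ℝ → X := fun t => Complex.exp (Complex.I * σ * l * t) • U (σ * t) x
  have hφ : Continuous φ :=
    Continuous.smul (by fun_prop) ((U.continuous x).comp (continuous_const_mul σ))
  have hint : IntegrableOn φ (Set.Ioi 0) := integrableOn_Ioi_of_resolventKernel_smul hσ
    (C0Group.integrable_resolventKernel_smul hU hσ hl x)
  have hRx : R x = (-Complex.I * σ) • ∫ t in Set.Ioi 0, φ t := by
    rw [hR, integral_resolventKernel_smul hσ]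
  have hshift : ∀ t τ : ℝ, U (σ * τ) (φ t) =
      Complex.exp (-(Complex.I * σ * l) * τ) • φ (t + τ) := by
    intro t τ
    simp only [φ]
    rw [map_smul, ← U.apply_add, smul_smul, ← Complex.exp_add]
    congr 2
    · push_cast; ring
    · congr 1; ring
  have horbit : (fun s => U s (R x)) = fun s : ℝ => (-Complex.I * σ) •
      Complex.exp (-(Complex.I * σ * l) * (σ * s : ℝ)) •
        ((∫ t in Set.Ioi 0, φ t) - ∫ t in (0 : ℝ)..(σ * s), φ t) := by
    funext s
    have := U.apply_integral_Ioi hφ hint hshift (σ * s)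
    rw [← mul_assoc, hσσ', one_mul] at this
    rw [hRx, map_smul, this]
  have hd1 : HasDerivAt (fun s : ℝ => σ * s) σ 0 := by
    simpa using (hasDerivAt_id (0 : ℝ)).const_mul σ
  have hd2 : HasDerivAt (fun s : ℝ => ∫ t in (0 : ℝ)..(σ * s), φ t) (σ • φ 0) 0 := by
    have h := (hφ.integral_hasStrictDerivAt 0 (σ * 0)).hasDerivAt.scomp (0 : ℝ) hd1
    rwa [mul_zero] at h
  have hd3 : HasDerivAt (fun s : ℝ => Complex.exp (-(Complex.I * σ * l) * (σ * s : ℝ)))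
      (-(Complex.I * l)) 0 := by
    have h1 : HasDerivAt (fun s : ℝ => -(Complex.I * σ * l) * (σ * s : ℝ))
        (-(Complex.I * σ * l) * σ) 0 := hd1.ofReal_comp.const_mul _
    have h2 := h1.cexp
    convert h2 using 1
    simp only [mul_zero, Complex.ofReal_zero, Complex.exp_zero, one_mul]
    linear_combination (Complex.I * l) * hσσ
  have hd := ((hd3.smul ((hasDerivAt_const (0 : ℝ) (∫ t in Set.Ioi 0, φ t)).sub hd2)).const_smul
    (-Complex.I * (σ : ℂ)))
  -- This derivative says that $Rx$ lies in the domain and $A R x = l R x - x$.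
  have hd' : HasDerivAt (fun s => U s (R x)) (-Complex.I • (l • R x - x)) 0 := by
    rw [horbit]
    refine hd.congr_deriv (Eq.symm ?_)
    have hφ0 : φ 0 = x := by simp [φ, U.apply_zero]
    rw [hφ0, hRx, ← Complex.coe_smul σ x]
    simp only [Pi.sub_apply, mul_zero, Complex.ofReal_zero, Complex.exp_zero, one_smul,
      intervalIntegral.integral_same, sub_zero, zero_sub]
    simp only [smul_sub, smul_add, smul_neg, smul_smul, neg_mul, neg_smul, neg_neg]
    rw [mul_assoc Complex.I (σ : ℂ) σ, hσσ, mul_one, add_comm, sub_neg_eq_add]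
    congr 2
    ring
  obtain ⟨y, hy, hAy⟩ := exists_of_hasDerivAt_orbit_zero hA hd'
  refine ⟨y, hy, ?_⟩
  rw [hAy, hy, smul_smul]
  simp

end Groups

/-! ### Operators given by weak orbit integrals -/

section OrbitIntegrals

variable {v : ℝ → ℝ} {ω : ℝ} {g h u : ℝ → ℂ}

/-- Weight and reciprocal weight cancel, so the pairing of $g$ and $u$ becomes an ordinary $L^2$
pairing. -/
theorem mul_eq_weighted_mul (hv : StronglyAdmissible v) (g u : ℝ → ℂ) (s : ℝ) :
    g s * u s = weighted v ω g s * (((Real.exp (-ω * |s|) / v s : ℝ) : ℂ) * u s) := by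
  have h1 : ((Real.exp (ω * |s|) * v s : ℝ) : ℂ) * ((Real.exp (-ω * |s|) / v s : ℝ) : ℂ) = 1 := by
    rw [← Complex.ofReal_mul, ← Complex.ofReal_one]
    congr 1
    have := (hv.pos s).ne'
    rw [neg_mul, Real.exp_neg]
    field_simp
  rw [weighted]
  linear_combination (-(g s * u s)) * h1

theorem norm_div_weight_mul_le (hv : StronglyAdmissible v) (hω : 0 ≤ ω) (φ : ℝ → ℂ) (s : ℝ) :
    ‖((Real.exp (-ω * |s|) / v s : ℝ) : ℂ) * φ s‖ ≤ ‖φ s‖ := by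
  have h1 := hv.one_le s
  have h2 : Real.exp (-ω * |s|) ≤ 1 := by
    rw [Real.exp_le_one_iff]
    nlinarith [mul_nonneg hω (abs_nonneg s)]
  rw [norm_mul, Complex.norm_real]
  refine mul_le_of_le_one_left (norm_nonneg _) ?_
  rw [Real.norm_of_nonneg (div_nonneg (Real.exp_pos _).le (hv.pos s).le), div_le_one (hv.pos s)]
  linarith

/-- The inverse weight turns `L²(ℝ)` into `L²_{v,ω}(ℝ)`. -/
theorem memWeightedL2_div_weight (hv : StronglyAdmissible v) (hω : 0 ≤ ω) {φ : ℝ → ℂ}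
    (hφ : MemLp φ 2 volume) :
    MemWeightedL2 v ω (fun s => ((Real.exp (-ω * |s|) / v s : ℝ) : ℂ) * φ s) ∧
      weighted v ω (fun s => ((Real.exp (-ω * |s|) / v s : ℝ) : ℂ) * φ s) = φ := by
  have hw : weighted v ω (fun s => ((Real.exp (-ω * |s|) / v s : ℝ) : ℂ) * φ s) = φ := by
    funext s
    have := mul_eq_weighted_mul (ω := ω) hv φ (fun _ => 1) s
    simp only [mul_one] at this
    rw [this, weighted, weighted]
    ring
  have hm : AEStronglyMeasurable
      (fun s => ((Real.exp (-ω * |s|) / v s : ℝ) : ℂ) * φ s) volume := by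
    have h1 := hv.measurable
    exact (Measurable.aestronglyMeasurable (by fun_prop)).mul hφ.1
  exact ⟨⟨hφ.mono hm (Filter.Eventually.of_forall (norm_div_weight_mul_le hv hω φ)), by rwa [hw]⟩,
    hw⟩

theorem MemWeightedL2.integrable_mul (hv : StronglyAdmissible v) (hg : MemWeightedL2 v ω g)
    (hu : MemLp (fun s : ℝ => ((Real.exp (-ω * |s|) / v s : ℝ) : ℂ) * u s) 2 volume) :
    Integrable fun s => g s * u s :=
  (hg.2.integrable_mul hu).congr
    (Filter.Eventually.of_forall fun s => (mul_eq_weighted_mul hv g u s).symm)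

theorem MemWeightedL2.norm_integral_mul_le (hv : StronglyAdmissible v) (hg : MemWeightedL2 v ω g)
    (hu : MemLp (fun s : ℝ => ((Real.exp (-ω * |s|) / v s : ℝ) : ℂ) * u s) 2 volume) :
    ‖∫ s, g s * u s‖ ≤ weightedL2Norm v ω g *
      (eLpNorm (fun s : ℝ => ((Real.exp (-ω * |s|) / v s : ℝ) : ℂ) * u s) 2 volume).toReal := by
  have h1 := eLpNorm_smul_le_mul_eLpNorm (p := 2) (q := 2) (r := 1) hu.1 hg.2.1
  have h2 : eLpNorm (fun s => g s * u s) 1 volume ≤ _ :=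
    (eLpNorm_congr_ae (Filter.Eventually.of_forall fun s => mul_eq_weighted_mul hv g u s)).trans_le
      h1
  rw [weightedL2Norm, ← ENNReal.toReal_mul, ← toReal_enorm]
  refine ENNReal.toReal_mono (ENNReal.mul_ne_top hg.2.2.ne hu.2.ne) ?_
  refine (enorm_integral_le_lintegral_enorm _).trans ?_
  rwa [← eLpNorm_one_eq_lintegral_enorm]

/-- Applied to both factors of a convolution, this gives the absolute convergence needed for Fubini.
-/
theorem MemWeightedL2.norm (hv : StronglyAdmissible v) (hg : MemWeightedL2 v ω g) :
    MemWeightedL2 v ω fun s => ((‖g s‖ : ℝ) : ℂ) := by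
  refine ⟨hg.1.norm.ofReal, ?_⟩
  have : weighted v ω (fun s => ((‖g s‖ : ℝ) : ℂ)) =
      fun s => ((‖weighted v ω g s‖ : ℝ) : ℂ) := by
    funext s
    rw [weighted, weighted, norm_mul, Complex.norm_real, Complex.ofReal_mul,
      Real.norm_of_nonneg (mul_pos (Real.exp_pos _) (hv.pos s)).le]
    push_cast
    ring
  rw [this]
  exact hg.2.norm.ofReal

theorem MemWeightedL2.sub (hg : MemWeightedL2 v ω g) (hh : MemWeightedL2 v ω h) :
    MemWeightedL2 v ω (g - h) := by
  rw [sub_eq_add_neg, ← neg_one_smul ℂ h]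
  exact hg.add (hh.smul _)

theorem MemWeightedL2.integrable (hv : StronglyAdmissible v) (hω : 0 ≤ ω)
    (hg : MemWeightedL2 v ω g) : Integrable g := by
  simpa using hg.integrable_kernel hv ⟨0, by simpa using hω⟩

theorem weighted_sub (g h : ℝ → ℂ) :
    weighted v ω (g - h) = weighted v ω g - weighted v ω h := by
  funext s; simp [weighted, mul_sub]

variable {X : Type*} [NormedAddCommGroup X] [NormedSpace ℂ X] {U : C0Group X}

/-- `T` is the weak integral `∫ g(s) U_s ds`. -/
def IsOrbitIntegral (U : C0Group X) (g : ℝ → ℂ) (T : X →L[ℂ] X) : Prop :=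
  ∀ (x : X) (x' : StrongDual ℂ X), Integrable (fun s => g s * x' (U s x)) ∧
    x' (T x) = ∫ s, g s * x' (U s x)

namespace IsOrbitIntegral

variable {S T : X →L[ℂ] X}

theorem unique (hT : IsOrbitIntegral U g T) (hS : IsOrbitIntegral U g S) : T = S := by
  ext x
  refine SeparatingDual.eq_iff_forall_dual_eq (R := ℂ).2 fun x' => ?_
  rw [(hT x x').2, (hS x x').2]

theorem congr (hT : IsOrbitIntegral U g T) (hgh : g =ᵐ[volume] h) : IsOrbitIntegral U h T := by
  intro x x'
  have h1 : (fun s => g s * x' (U s x)) =ᵐ[volume] fun s => h s * x' (U s x) := by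
    filter_upwards [hgh] with s hs
    rw [hs]
  exact ⟨(hT x x').1.congr h1, (hT x x').2.trans (integral_congr_ae h1)⟩

theorem add (hT : IsOrbitIntegral U g T) (hS : IsOrbitIntegral U h S) :
    IsOrbitIntegral U (g + h) (T + S) := by
  intro x x'
  simp only [Pi.add_apply, add_mul, _root_.add_apply, map_add]
  exact ⟨(hT x x').1.add (hS x x').1, by
    rw [(hT x x').2, (hS x x').2, integral_add (hT x x').1 (hS x x').1]⟩

theorem smul (c : ℂ) (hT : IsOrbitIntegral U g T) : IsOrbitIntegral U (c • g) (c • T) := by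
  intro x x'
  simp only [Pi.smul_apply, smul_eq_mul, mul_assoc, _root_.smul_apply, map_smul]
  exact ⟨(hT x x').1.const_mul c, by rw [(hT x x').2, integral_const_mul]⟩

theorem sub (hT : IsOrbitIntegral U g T) (hS : IsOrbitIntegral U h S) :
    IsOrbitIntegral U (g - h) (T - S) := by
  have := hT.add (hS.smul (-1))
  rwa [neg_one_smul, neg_one_smul, ← sub_eq_add_neg, ← sub_eq_add_neg] at this

/-- Convolutions act as products. -/
theorem convolution (hv : StronglyAdmissible v) (hω : 0 ≤ ω)
    (hU : ∀ (x : X) (x' : StrongDual ℂ X),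
      MemLp (fun s : ℝ => ((Real.exp (-ω * |s|) / v s : ℝ) : ℂ) * x' (U s x)) 2 volume)
    (hg : MemWeightedL2 v ω g) (hh : MemWeightedL2 v ω h)
    (hT : IsOrbitIntegral U g T) (hS : IsOrbitIntegral U h S) :
    IsOrbitIntegral U (g ⋆[ContinuousLinearMap.mul ℝ ℂ, volume] h) (T * S) := by
  intro x x'
  refine ⟨(hg.convolution hv hω hh).integrable_mul hv (hU x x'), ?_⟩
  have hgi := hg.integrable hv hω
  have hhi := hh.integrable hv hω
  have hu : Continuous fun s => x' (U s x) := x'.continuous.comp (U.continuous x)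
  have hprod : Integrable (fun p : ℝ × ℝ => g p.2 * h (p.1 - p.2) * x' (U p.1 x))
      (volume.prod volume) := by
    rw [integrable_prod_iff]
    · refine ⟨?_, ?_⟩
      · filter_upwards [hgi.ae_convolution_exists (ContinuousLinearMap.mul ℝ ℂ) hhi] with r hr
        exact Integrable.mul_const hr _
      -- The inner integral of norms is $(|g| * |h|)(r)\,|\langle U_r x,x'\rangle|$, and $|g| * |h|$
      -- again lies in $L^2_{v,\omega}$.
      · refine (((hg.norm hv).convolution hv hω (hh.norm hv)).integrable_mul hv (hU x x')).norm.congr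
          (Filter.Eventually.of_forall fun r => ?_)
        have h1 : ((fun s => ((‖g s‖ : ℝ) : ℂ)) ⋆[ContinuousLinearMap.mul ℝ ℂ, volume]
            fun s => ((‖h s‖ : ℝ) : ℂ)) r = ((∫ s, ‖g s‖ * ‖h (r - s)‖ : ℝ) : ℂ) := by
          rw [convolution_def, ← integral_complex_ofReal]
          simp
        simp only [norm_mul]
        rw [h1, integral_mul_const, Complex.norm_real,
          Real.norm_of_nonneg (integral_nonneg fun s => by positivity)]
    · exact (hgi.aestronglyMeasurable.convolution_integrand (ContinuousLinearMap.mul ℝ ℂ)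
        hhi.aestronglyMeasurable).mul (hu.comp continuous_fst).aestronglyMeasurable
  calc x' ((T * S) x) = ∫ s, g s * x' (U s (S x)) := (hT (S x) x').2
    _ = ∫ s, ∫ r, g s * h (r - s) * x' (U r x) := by
        refine integral_congr_ae (Filter.Eventually.of_forall fun s => ?_)
        -- Testing $S$ against $x' \circ U_s$ gives $\int h(r)\langle
        -- U_{s+r}x,x'\rangle\,\mathrm{d}r$; a translation then produces $h(r-s)$.
        have h1 := (hS x (x'.comp (U s))).2
        simp only [ContinuousLinearMap.comp_apply, ← U.apply_add] at h1
        simp only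
        rw [h1, ← integral_const_mul, ← integral_sub_right_eq_self _ s]
        refine integral_congr_ae (Filter.Eventually.of_forall fun r => ?_)
        simp only [add_sub_cancel, mul_assoc]
    _ = ∫ r, ∫ s, g s * h (r - s) * x' (U r x) :=
        (integral_integral_swap hprod).symm
    _ = _ := by
        refine integral_congr_ae (Filter.Eventually.of_forall fun r => ?_)
        simp only [integral_mul_const]
        rfl

/-- Uniform bound for weak orbit integrals under the square-integrability condition. -/
theorem exists_norm_le [CompleteSpace X] (hv : StronglyAdmissible v)
    (hU : ∀ (x : X) (x' : StrongDual ℂ X),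
      MemLp (fun s : ℝ => ((Real.exp (-ω * |s|) / v s : ℝ) : ℂ) * x' (U s x)) 2 volume) :
    ∃ C, ∀ g T, MemWeightedL2 v ω g → IsOrbitIntegral U g T → ‖T‖ ≤ C * weightedL2Norm v ω g := by
  let N : X → StrongDual ℂ X → ℝ := fun x x' =>
    (eLpNorm (fun s : ℝ => ((Real.exp (-ω * |s|) / v s : ℝ) : ℂ) * x' (U s x)) 2 volume).toReal
  have hweak : ∀ g T, MemWeightedL2 v ω g → IsOrbitIntegral U g T → ∀ x x',
      ‖x' (T x)‖ ≤ weightedL2Norm v ω g * N x x' := fun g T hg hT x x' => by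
    rw [(hT x x').2]
    exact hg.norm_integral_mul_le hv (hU x x')
  let ι := {p : (ℝ → ℂ) × (X →L[ℂ] X) // MemWeightedL2 v ω p.1 ∧ IsOrbitIntegral U p.1 p.2}
  let r : ι → ℝ := fun p => weightedL2Norm v ω p.1.1
  have hr : ∀ p, 0 ≤ r p := fun p => ENNReal.toReal_nonneg
  -- If the norm vanishes, the inverse is $0$ by convention and `Q p` is zero; that case is settled
  -- separately at the end.
  let Q : ι → X →L[ℂ] X := fun p => (((r p)⁻¹ : ℝ) : ℂ) • p.1.2
  have hQ : ∀ p x x', ‖x' (Q p x)‖ ≤ N x x' := by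
    intro p x x'
    have h1 := hweak _ _ p.2.1 p.2.2 x x'
    have hN : 0 ≤ N x x' := ENNReal.toReal_nonneg
    simp only [Q, _root_.smul_apply, map_smul, norm_smul, Complex.norm_real,
      norm_inv, Real.norm_of_nonneg (hr p)]
    rcases (hr p).eq_or_lt with h | h
    · simpa [← h] using hN
    · rwa [inv_mul_le_iff₀ h]
  -- For fixed $x$ the vectors `Q p x`, seen in the bidual, are bounded pointwise on $X'$ and hence
  -- in norm. A second application on $X$ bounds the operators.
  obtain ⟨C, hC⟩ := banach_steinhaus (g := Q) fun x => by
    obtain ⟨C, hC⟩ := banach_steinhaus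
      (g := fun p : ι => NormedSpace.inclusionInDoubleDualLi ℂ (Q p x))
      fun x' => ⟨N x x', fun p => hQ p x x'⟩
    exact ⟨C, fun p =>
      ((NormedSpace.inclusionInDoubleDualLi ℂ).norm_map (Q p x)).symm.trans_le (hC p)⟩
  refine ⟨C, fun g T hg hT => ?_⟩
  have h1 := hC ⟨(g, T), hg, hT⟩
  have h0 : 0 ≤ weightedL2Norm v ω g := ENNReal.toReal_nonneg
  rcases h0.eq_or_lt with h | h
  · have hT0 : T = 0 := by
      ext x
      refine SeparatingDual.eq_iff_forall_dual_eq (R := ℂ).2 fun x' => ?_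
      have := hweak g T hg hT x x'
      rw [← h, zero_mul, norm_le_zero_iff] at this
      simpa using this
    rw [hT0, ← h]; simp
  · simp only [Q, r, norm_smul, Complex.norm_real, norm_inv, Real.norm_of_nonneg h0] at h1
    rwa [inv_mul_le_iff₀ h, mul_comm] at h1

/-- Here the growth bound makes $\int g(s)U_s x\,\mathrm{d}s$ a Bochner integral, so it lands in $X$
and not merely in the bidual. -/
theorem exists_of_integrable_exp [CompleteSpace X] {C a : ℝ} (hU : ∀ s, ‖U s‖ ≤ C * Real.exp (a * |s|))
    (hg : Integrable fun s => ((Real.exp (a * |s|) : ℝ) : ℂ) * g s) :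
    ∃ T, IsOrbitIntegral U g T := by
  have hmeas : AEStronglyMeasurable g volume := by
    have h1 : AEStronglyMeasurable (fun s : ℝ => ((Real.exp (-(a * |s|)) : ℝ) : ℂ)) volume :=
      Continuous.aestronglyMeasurable (by fun_prop)
    refine (h1.mul hg.1).congr (Filter.Eventually.of_forall fun s => ?_)
    simp only [Pi.mul_apply]
    rw [← mul_assoc, ← Complex.ofReal_mul, ← Real.exp_add]
    simp
  have hle : ∀ x s, ‖g s • U s x‖ ≤ ‖((Real.exp (a * |s|) : ℝ) : ℂ) * g s‖ * (C * ‖x‖) := by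
    intro x s
    have h1 := (U s).le_of_opNorm_le (hU s) x
    rw [norm_smul, norm_mul, Complex.norm_real, Real.norm_of_nonneg (Real.exp_pos _).le]
    calc ‖g s‖ * ‖U s x‖ ≤ ‖g s‖ * (C * Real.exp (a * |s|) * ‖x‖) := by gcongr
      _ = _ := by ring
  have hint : ∀ x, Integrable fun s => g s • U s x := fun x =>
    (hg.norm.mul_const _).mono' (hmeas.smul (U.continuous x).aestronglyMeasurable)
      (Filter.Eventually.of_forall (hle x))
  let T : X →ₗ[ℂ] X :=
    { toFun := fun x => ∫ s, g s • U s x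
      map_add' := fun x y => by
        simp only [map_add, smul_add]
        exact integral_add (hint x) (hint y)
      map_smul' := fun c x => by
        simp only [map_smul, RingHom.id_apply]
        rw [← integral_smul]
        exact integral_congr_ae (Filter.Eventually.of_forall fun s => smul_comm _ _ _) }
  refine ⟨T.mkContinuous ((∫ s, ‖((Real.exp (a * |s|) : ℝ) : ℂ) * g s‖) * C) fun x => ?_,
    fun x x' => ⟨?_, ?_⟩⟩
  · rw [mul_assoc, ← integral_mul_const]
    exact norm_integral_le_of_norm_le (hg.norm.mul_const _) (Filter.Eventually.of_forall (hle x))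
  · simpa using x'.integrable_comp (hint x)
  · change x' (∫ s, g s • U s x) = _
    rw [← ContinuousLinearMap.integral_comp_comm _ (hint x)]
    simp

/-- Under the square-integrability condition, `∫ g(s) U_s ds` exists for all `g ∈ L²_{v,ω}(ℝ)`. -/
theorem exists_of_memWeightedL2 [CompleteSpace X] (hv : StronglyAdmissible v) (hω : 0 ≤ ω)
    (hU : ∀ (x : X) (x' : StrongDual ℂ X),
      MemLp (fun s : ℝ => ((Real.exp (-ω * |s|) / v s : ℝ) : ℂ) * x' (U s x)) 2 volume)
    (hg : MemWeightedL2 v ω g) : ∃ T, IsOrbitIntegral U g T := by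
  obtain ⟨C, a, hCa⟩ := U.exists_norm_le_exp
  obtain ⟨K, hK⟩ := exists_norm_le hv hU
  -- The weighted function is approximated in $L^2$ by `φ` continuous with compact support; dividing
  -- by the weight gives `f`, which stays integrable against any exponential.
  have happrox : ∀ n : ℕ, ∃ f T, MemWeightedL2 v ω f ∧ IsOrbitIntegral U f T ∧
      weightedL2Norm v ω (g - f) ≤ 1 / (n + 1 : ℝ) := by
    intro n
    have hn : (0 : ℝ) < 1 / (n + 1 : ℝ) := by positivity
    obtain ⟨φ, hφc, hφ, hφcont, hφ2⟩ := hg.2.exists_hasCompactSupport_eLpNorm_sub_le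
      ENNReal.ofNat_ne_top (ENNReal.ofReal_pos.2 hn).ne'
    let f : ℝ → ℂ := fun s => ((Real.exp (-ω * |s|) / v s : ℝ) : ℂ) * φ s
    obtain ⟨hfmem, hwf⟩ : MemWeightedL2 v ω f ∧ weighted v ω f = φ :=
      memWeightedL2_div_weight hv hω hφ2
    have hfle : ∀ s, ‖f s‖ ≤ ‖φ s‖ := norm_div_weight_mul_le hv hω φ
    have hφi : Integrable fun s => ((Real.exp (a * |s|) : ℝ) : ℂ) * φ s :=
      Continuous.integrable_of_hasCompactSupport (by fun_prop) hφc.mul_left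
    obtain ⟨T, hT⟩ := exists_of_integrable_exp (g := f) hCa (hφi.mono
      ((Continuous.aestronglyMeasurable (by fun_prop)).mul hfmem.1.1)
      (Filter.Eventually.of_forall fun s => by
        refine (norm_mul _ (f s)).trans_le (le_of_le_of_eq ?_ (norm_mul _ (φ s)).symm)
        exact mul_le_mul_of_nonneg_left (hfle s) (norm_nonneg _)))
    refine ⟨f, T, hfmem, hT, ?_⟩
    rw [weightedL2Norm, weighted_sub, hwf]
    exact ENNReal.toReal_le_of_le_ofReal hn.le hφ
  choose f T hf hT hfT using happrox
  have hK0 : ∀ p q : ℕ, ‖T p - T q‖ ≤ |K| * (1 / (p + 1 : ℝ) + 1 / (q + 1 : ℝ)) := by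
    intro p q
    refine (hK _ _ ((hf p).sub (hf q)) ((hT p).sub (hT q))).trans ?_
    refine (mul_le_mul_of_nonneg_right (le_abs_self K) ENNReal.toReal_nonneg).trans ?_
    gcongr
    have h1 : weighted v ω (f p - f q) = weighted v ω (g - f q) - weighted v ω (g - f p) := by
      rw [← weighted_sub]; congr 1; abel
    have h2 := eLpNorm_sub_le (hg.sub (hf q)).2.1 (hg.sub (hf p)).2.1 (p := 2) one_le_two
    rw [← h1] at h2
    have h3 := ENNReal.toReal_mono (ENNReal.add_ne_top.2
      ⟨(hg.sub (hf q)).2.2.ne, (hg.sub (hf p)).2.2.ne⟩) h2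
    rw [ENNReal.toReal_add (hg.sub (hf q)).2.2.ne (hg.sub (hf p)).2.2.ne] at h3
    have h4 := hfT p
    have h5 := hfT q
    simp only [weightedL2Norm] at h4 h5 ⊢
    linarith
  have hlim0 := tendsto_one_div_add_atTop_nhds_zero_nat (𝕜 := ℝ)
  have hcau : CauchySeq T := by
    refine cauchySeq_of_le_tendsto_0 (fun n : ℕ => |K| * (1 / (n + 1 : ℝ) + 1 / (n + 1 : ℝ)))
      (fun p q n hp hq => ?_) ?_
    · rw [dist_eq_norm]
      refine (hK0 p q).trans ?_
      gcongr
    · simpa using (hlim0.add hlim0).const_mul |K|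
  obtain ⟨S, hS⟩ := cauchySeq_tendsto_of_complete hcau
  refine ⟨S, fun x x' => ⟨hg.integrable_mul hv (hU x x'), ?_⟩⟩
  have h1 : Filter.Tendsto (fun n => x' (T n x)) Filter.atTop (nhds (x' (S x))) :=
    (x'.continuous.tendsto _).comp
      (((ContinuousLinearMap.apply ℂ X x).continuous.tendsto S).comp hS)
  -- The norm limit has the right weak integrals, since by Cauchy–Schwarz these depend continuously
  -- on $g$.
  refine tendsto_nhds_unique h1 (tendsto_iff_norm_sub_tendsto_zero.2 ?_)
  have h2 := hlim0.mul_const (eLpNorm (fun s : ℝ =>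
    ((Real.exp (-ω * |s|) / v s : ℝ) : ℂ) * x' (U s x)) 2 volume).toReal
  rw [zero_mul] at h2
  refine squeeze_zero (fun n => norm_nonneg _) (fun n => ?_) h2
  rw [norm_sub_rev, (hT n x x').2,
    ← integral_sub (hg.integrable_mul hv (hU x x')) (hT n x x').1]
  have h3 := (hg.sub (hf n)).norm_integral_mul_le hv (hU x x')
  simp only [Pi.sub_apply, sub_mul] at h3
  exact h3.trans (mul_le_mul_of_nonneg_right (hfT n) ENNReal.toReal_nonneg)

end IsOrbitIntegral

end OrbitIntegrals

/-! ### The calculus and the group -/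

section Calculus

variable {v : ℝ → ℝ} {ω : ℝ} {f k : ClosedStrip ω → ℂ} {g h : ℝ → ℂ}

theorem IsInvFourier.add (hv : StronglyAdmissible v) (hg : IsInvFourier v ω f g)
    (hh : IsInvFourier v ω k h) : IsInvFourier v ω (f + k) (g + h) := by
  refine ⟨hg.1.add hh.1, ?_⟩
  rw [hg.2, hh.2]
  funext z
  simp only [Pi.add_apply, stripFourier, mul_add]
  exact (integral_add (hg.1.integrable_kernel hv z) (hh.1.integrable_kernel hv z)).symm

theorem IsInvFourier.smul (c : ℂ) (hg : IsInvFourier v ω f g) :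
    IsInvFourier v ω (c • f) (c • g) := by
  refine ⟨hg.1.smul c, ?_⟩
  rw [hg.2]
  funext z
  simp only [Pi.smul_apply, stripFourier, smul_eq_mul]
  rw [← integral_const_mul]
  exact integral_congr_ae (Filter.Eventually.of_forall fun s => by ring)

theorem IsInvFourier.mul (hv : StronglyAdmissible v) (hω : 0 ≤ ω) (hg : IsInvFourier v ω f g)
    (hh : IsInvFourier v ω k h) :
    IsInvFourier v ω (f * k) (g ⋆[ContinuousLinearMap.mul ℝ ℂ, volume] h) := by
  refine ⟨hg.1.convolution hv hω hh.1, ?_⟩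
  rw [hg.2, hh.2, stripFourier_convolution hv hg.1 hh.1]

theorem isInvFourier_zero : IsInvFourier v ω 0 0 :=
  ⟨memWeightedL2_zero, by funext z; simp [stripFourier]⟩

theorem IsInvFourier.congr (hg : IsInvFourier v ω f g) (hgh : g =ᵐ[volume] h) :
    IsInvFourier v ω f h := by
  refine ⟨⟨hg.1.1.ae_eq hgh, hg.1.2.ae_eq ?_⟩, ?_⟩
  · filter_upwards [hgh] with s hs
    rw [weighted, weighted, hs]
  · rw [hg.2]
    funext z
    refine integral_congr_ae ?_
    filter_upwards [hgh] with s hs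
    rw [hs]

variable {X : Type*} [NormedAddCommGroup X] [NormedSpace ℂ X] {U : C0Group X} {A : X →ₗ.[ℂ] X}

/-- The function `(l - z)⁻¹` as an element of the Sobolev algebra. -/
theorem exists_resolvent_mem (hv : StronglyAdmissible v) (hω : 0 ≤ ω) {l : ℂ}
    (hl : ω < |l.im|) :
    ∃ r : sobolevAlgebra hv hω, ∀ z : ClosedStrip ω, (r : ClosedStrip ω → ℂ) z = (l - z)⁻¹ := by
  obtain ⟨σ, hσ, hσl⟩ := exists_sign_of_lt_abs_im hl
  exact ⟨⟨_, _, isInvFourier_resolventKernel hv hω hσ hσl⟩, fun _ => rfl⟩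

/-- A Sobolev calculus that yields one resolvent yields all of them. -/
theorem MapsToResolvent.of_mapsToResolvent {hv : StronglyAdmissible v} {hω : 0 ≤ ω}
    {Ψ : sobolevAlgebra hv hω →ₙₐ[ℂ] (X →L[ℂ] X)} {l m : ℂ} (hl : ω < |l.im|) (hm : ω < |m.im|)
    (h : MapsToResolvent hv hω A Ψ l) : MapsToResolvent hv hω A Ψ m := by
  obtain ⟨r, hr, hR⟩ := h
  obtain ⟨q, hq⟩ := exists_resolvent_mem hv hω hm
  refine ⟨q, hq, ?_⟩
  have hne : ∀ {n : ℂ}, ω < |n.im| → ∀ z : ClosedStrip ω, n - z ≠ 0 := by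
    intro n hn z h0
    rw [sub_eq_zero.1 h0] at hn
    exact absurd z.2 (not_le.2 hn)
  -- This is the resolvent identity for the scalar functions. Since $\Psi$ is multiplicative, it
  -- passes to operators in both orders of the factors.
  have h1 : r = q + (m - l) • (r * q) := by
    refine Subtype.ext (funext fun z => ?_)
    have h2 := hne hl z
    have h3 := hne hm z
    change (r : ClosedStrip ω → ℂ) z = (q : ClosedStrip ω → ℂ) z +
      (m - l) * ((r : ClosedStrip ω → ℂ) z * (q : ClosedStrip ω → ℂ) z)
    rw [hr, hq]
    field_simp
    ring
  have e1 : ∀ x, Ψ r x = Ψ q x + (m - l) • Ψ r (Ψ q x) := fun x => by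
    conv_lhs => rw [h1]
    rw [map_add, map_smul, map_mul]; rfl
  have e2 : ∀ x, Ψ r x = Ψ q x + (m - l) • Ψ q (Ψ r x) := fun x => by
    conv_lhs => rw [h1, mul_comm r q]
    rw [map_add, map_smul, map_mul]; rfl
  refine ⟨fun y => ?_, fun x => ?_⟩
  · have h2 := hR.1 y
    have h3 := e2 (l • (y : X) - A y)
    rw [h2] at h3
    have h4 : m • (y : X) - A y = (l • (y : X) - A y) + (m - l) • (y : X) := by module
    rw [h4, map_add, map_smul, ← h3]
  -- The argument is chosen so that applying $\Psi(r)$ returns $\Psi(q)x$, which places $\Psi(q)x$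
  -- in the domain.
  · obtain ⟨y, hy, hyx⟩ := hR.2 (x - (m - l) • Ψ q x)
    have h2 : (y : X) = Ψ q x := by
      rw [hy, map_sub, map_smul, e1 x]; abel
    refine ⟨y, h2, ?_⟩
    have h4 : m • (y : X) - A y = (l • (y : X) - A y) + (m - l) • (y : X) := by module
    rw [h4, hyx, h2]; abel

/-- Functionals of a bounded calculus are given by densities. -/
theorem IsBoundedSobolevCalculus.exists_density {hv : StronglyAdmissible v} {hω : 0 ≤ ω}
    {Ψ : sobolevAlgebra hv hω →ₙₐ[ℂ] (X →L[ℂ] X)} (hΨ : IsBoundedSobolevCalculus hv hω A Ψ)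
    (x : X) (x' : StrongDual ℂ X) :
    ∃ u : ℝ → ℂ, MemLp (fun s : ℝ => ((Real.exp (-ω * |s|) / v s : ℝ) : ℂ) * u s) 2 volume ∧
      ∀ (f : sobolevAlgebra hv hω) (g : ℝ → ℂ), IsInvFourier v ω (f : ClosedStrip ω → ℂ) g →
        x' (Ψ f x) = ∫ s, g s * u s := by
  obtain ⟨C, hC⟩ := hΨ.bounded
  let w : ℝ → ℂ := fun s => ((Real.exp (-ω * |s|) / v s : ℝ) : ℂ)
  -- Division by the weight parametrises $L^2_{v,\omega}$ isometrically by $L^2$, where Riesz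
  -- representation is available.
  let D : Lp ℂ 2 (volume : Measure ℝ) → ℝ → ℂ := fun φ s => w s * φ s
  have hD : ∀ φ, MemWeightedL2 v ω (D φ) ∧ weighted v ω (D φ) = φ := fun φ =>
    memWeightedL2_div_weight hv hω (Lp.memLp φ)
  let F : Lp ℂ 2 (volume : Measure ℝ) → sobolevAlgebra hv hω := fun φ =>
    ⟨stripFourier ω (D φ), D φ, (hD φ).1, rfl⟩
  have hF : ∀ φ, IsInvFourier v ω (F φ : ClosedStrip ω → ℂ) (D φ) := fun φ => ⟨(hD φ).1, rfl⟩
  have hFeq : ∀ (f : sobolevAlgebra hv hω) (g : ℝ → ℂ) (φ : Lp ℂ 2 (volume : Measure ℝ)),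
      IsInvFourier v ω (f : ClosedStrip ω → ℂ) g → g =ᵐ[volume] D φ → f = F φ := by
    intro f g φ hg hgD
    exact Subtype.ext (hg.congr hgD).2
  let L₀ : Lp ℂ 2 (volume : Measure ℝ) →ₗ[ℂ] ℂ :=
    { toFun := fun φ => x' (Ψ (F φ) x)
      map_add' := fun φ ψ => by
        rw [← hFeq (F φ + F ψ) (D φ + D ψ) (φ + ψ) ((hF φ).add hv (hF ψ)) ?_, map_add]
        · simp
        · filter_upwards [Lp.coeFn_add φ ψ] with s hs
          simp only [D, Pi.add_apply, hs, mul_add]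
      map_smul' := fun c φ => by
        rw [← hFeq (c • F φ) (c • D φ) (c • φ) ((hF φ).smul c) ?_, map_smul]
        · simp
        · filter_upwards [Lp.coeFn_smul c φ] with s hs
          simp only [D, Pi.smul_apply, hs, smul_eq_mul]
          ring }
  let L : StrongDual ℂ (Lp ℂ 2 (volume : Measure ℝ)) :=
    L₀.mkContinuous (‖x'‖ * C * ‖x‖) fun φ => by
      have h1 := hC (F φ) (D φ) (hF φ)
      rw [weightedL2Norm, (hD φ).2, ← Lp.norm_def] at h1
      calc ‖x' (Ψ (F φ) x)‖ ≤ ‖x'‖ * (C * ‖φ‖ * ‖x‖) :=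
            x'.le_opNorm_of_le ((Ψ (F φ)).le_of_opNorm_le h1 x)
        _ = ‖x'‖ * C * ‖x‖ * ‖φ‖ := by ring
  obtain ⟨ζ, hζ⟩ := (InnerProductSpace.toDual ℂ (Lp ℂ 2 (volume : Measure ℝ))).surjective L
  -- The conjugate compensates for the antilinear first slot of the inner product.
  let u : ℝ → ℂ := weighted v ω fun s => starRingEnd ℂ (ζ s)
  have hwu : ∀ s, w s * u s = starRingEnd ℂ (ζ s) := fun s => by
    have := mul_eq_weighted_mul (ω := ω) hv (fun s => starRingEnd ℂ (ζ s)) (fun _ => 1) s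
    simp only [mul_one] at this
    rw [this, mul_comm]
  refine ⟨u, ?_, fun f g hg => ?_⟩
  · exact (Lp.memLp ζ).star.ae_eq (Filter.Eventually.of_forall fun s => (hwu s).symm)
  · let φ := hg.1.2.toLp (weighted v ω g)
    have hφ : φ =ᵐ[volume] weighted v ω g := hg.1.2.coeFn_toLp
    have hgD : g =ᵐ[volume] D φ := by
      filter_upwards [hφ] with s hs
      have := mul_eq_weighted_mul (ω := ω) hv g (fun _ => 1) s
      simp only [mul_one] at this
      rw [this]
      simp only [D, hs]
      rw [mul_comm]
    rw [hFeq f g φ hg hgD]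
    change L φ = _
    rw [← hζ, InnerProductSpace.toDual_apply_apply, L2.inner_def]
    refine integral_congr_ae ?_
    filter_upwards [hφ] with s hs
    rw [mul_eq_weighted_mul (ω := ω) hv g u s, hs, RCLike.inner_apply]
    congr 1
    exact (hwu s).symm

variable [CompleteSpace X]

/-- Square integrability of the weighted orbits yields a bounded calculus. -/
theorem hasBoundedSobolevCalculus_of_memLp (hA : (-Complex.I) • A = U.generator)
    (hv : StronglyAdmissible v) (hω : 0 ≤ ω)
    (hU : ∀ (x : X) (x' : StrongDual ℂ X),
      MemLp (fun s : ℝ => ((Real.exp (-ω * |s|) / v s : ℝ) : ℂ) * x' (U s x)) 2 volume) :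
    HasBoundedSobolevCalculus hv hω A := by
  have hex : ∀ f : sobolevAlgebra hv hω, ∃ T : X →L[ℂ] X, ∀ g,
      IsInvFourier v ω (f : ClosedStrip ω → ℂ) g → IsOrbitIntegral U g T := by
    rintro ⟨f, g, hg⟩
    obtain ⟨T, hT⟩ := IsOrbitIntegral.exists_of_memWeightedL2 hv hω hU hg.1
    exact ⟨T, fun k hk => hT.congr (hg.ae_eq hv hω hk)⟩
  choose Ψ hΨ using hex
  let Φ : sobolevAlgebra hv hω →ₙₐ[ℂ] (X →L[ℂ] X) :=
    { toFun := Ψ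
      map_smul' := fun c f => by
        obtain ⟨g, hg⟩ := f.2
        exact (hΨ (c • f) _ (hg.smul c)).unique ((hΨ f g hg).smul c)
      map_zero' := by
        refine (hΨ 0 0 isInvFourier_zero).unique fun x x' => ?_
        simp
      map_add' := fun f k => by
        obtain ⟨g, hg⟩ := f.2
        obtain ⟨h, hh⟩ := k.2
        exact (hΨ (f + k) _ (hg.add hv hh)).unique ((hΨ f g hg).add (hΨ k h hh))
      map_mul' := fun f k => by
        obtain ⟨g, hg⟩ := f.2
        obtain ⟨h, hh⟩ := k.2
        exact (hΨ (f * k) _ (hg.mul hv hω hh)).unique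
          ((hΨ f g hg).convolution hv hω hU hg.1 hh.1 (hΨ k h hh)) }
  obtain ⟨K, hK⟩ := IsOrbitIntegral.exists_norm_le hv hU
  refine ⟨Φ, ⟨K, fun f g hg => hK g _ hg.1 (hΨ f g hg)⟩, ?_⟩
  obtain ⟨C, a, hCa⟩ := U.exists_norm_le_exp
  -- Height above $\omega$ puts $(l-z)^{-1}$ in the algebra; height above the growth rate `a` makes
  -- the orbit's Laplace integral converge.
  let l : ℂ := (max ω a + 1 : ℝ) * Complex.I
  have hlim : l.im = max ω a + 1 := by simp [l]
  have hlω : ω < l.im := by rw [hlim]; linarith [le_max_left ω a]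
  have hla : a < l.im := by rw [hlim]; linarith [le_max_right ω a]
  have hσ : |(1 : ℝ)| = 1 := abs_one
  refine ⟨l, hlω.trans_le (le_abs_self _), ?_⟩
  have hinv := isInvFourier_resolventKernel hv hω hσ (by rwa [one_mul] : ω < 1 * l.im)
  refine ⟨⟨_, _, hinv⟩, fun _ => rfl, ?_⟩
  refine isResolvent_of_apply_eq_integral hA hCa hσ (by rwa [one_mul]) fun x => ?_
  refine SeparatingDual.eq_iff_forall_dual_eq (R := ℂ).2 fun x' => ?_
  rw [← ContinuousLinearMap.integral_comp_comm _
    (C0Group.integrable_resolventKernel_smul hCa hσ (by rwa [one_mul]) x)]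
  refine ((hΨ ⟨_, _, hinv⟩ _ hinv) x x').2.trans ?_
  simp

/-! ### Uniqueness of Fourier and Laplace transforms, and recovery of the orbits -/

/-- An integrable function with vanishing Fourier transform vanishes almost everywhere. -/
theorem ae_eq_zero_of_fourier_eq_zero {f : ℝ → ℂ} (hf : Integrable f)
    (hF : ∀ ξ : ℝ, ∫ s : ℝ, Complex.exp (-Complex.I * s * ξ) * f s = 0) :
    f =ᵐ[volume] 0 := by
  refine ae_eq_zero_of_integral_contDiff_smul_eq_zero hf.locallyIntegrable ?_
  intro ψ hψ hψc
  have hc : HasCompactSupport (fun x => ((ψ x : ℝ) : ℂ)) :=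
    hψc.comp_left (g := fun r : ℝ => (r : ℂ)) (by simp)
  let φ : SchwartzMap ℝ ℂ := hc.toSchwartzMap (Complex.ofRealCLM.contDiff.comp hψ)
  -- Writing the test function as $\widehat\chi$ allows the multiplication formula $\int \widehat
  -- f\,\chi = \int f\,\widehat\chi$.
  let χ : SchwartzMap ℝ ℂ := FourierTransformInv.fourierInv φ
  have hχ : FourierTransform.fourier χ = φ := FourierTransform.fourier_fourierInv_eq φ
  have key := VectorFourier.integral_bilin_fourierIntegral_eq_flip (ContinuousLinearMap.mul ℂ ℂ)
    (L := innerₗ ℝ) Real.continuous_fourierChar continuous_inner hf (χ.integrable (μ := volume))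
  have e1 : ∀ ξ : ℝ, VectorFourier.fourierIntegral Real.fourierChar volume (innerₗ ℝ) f ξ
      = 0 := fun ξ => by
    change FourierTransform.fourier f ξ = 0
    rw [Real.fourier_real_eq_integral_exp_smul, ← hF (2 * Real.pi * ξ)]
    refine integral_congr_ae (Filter.Eventually.of_forall fun s => ?_)
    simp only [smul_eq_mul]
    congr 2
    push_cast
    ring
  have e2 : ∀ x : ℝ, VectorFourier.fourierIntegral Real.fourierChar volume (innerₗ ℝ).flip χ x
      = φ x := fun x => by
    rw [flip_innerₗ, ← hχ]; rfl
  simp only [e1, e2, ContinuousLinearMap.mul_apply', zero_mul, integral_zero] at key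
  rw [key]
  refine integral_congr_ae (Filter.Eventually.of_forall fun s => ?_)
  change ψ s • f s = f s * ((ψ s : ℝ) : ℂ)
  rw [Complex.real_smul, mul_comm]

/-- Laplace transforms determine a function on a half-line. -/
theorem ae_eq_zero_of_integral_resolventKernel_eq_zero {σ b : ℝ} (hσ : |σ| = 1) {D : ℝ → ℂ}
    (hD : ∀ l : ℂ, b < σ * l.im → Integrable (fun s => resolventKernel σ l s * D s) ∧
      ∫ s, resolventKernel σ l s * D s = 0) :
    ∀ᵐ s : ℝ, 0 < σ * s → D s = 0 := by
  have hσσ : σ * σ = 1 := by rw [← abs_mul_abs_self, hσ, one_mul]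
  -- Moving `l` along a horizontal line modulates the kernel, so the vanishing Laplace transforms
  -- are exactly the Fourier transform of kernel times `D`.
  let l : ℂ := (σ * (b + 1) : ℝ) * Complex.I
  have hl : ∀ ξ : ℝ, b < σ * (l - ξ).im := fun ξ => by
    have : (l - ξ).im = σ * (b + 1) := by simp [l]
    rw [this, ← mul_assoc, hσσ]; linarith
  have hl0 : b < σ * l.im := by simpa using hl 0
  have h1 := ae_eq_zero_of_fourier_eq_zero (hD l hl0).1 fun ξ => by
    rw [← (hD (l - ξ) (hl ξ)).2]
    refine integral_congr_ae (Filter.Eventually.of_forall fun s => ?_)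
    simp only
    rw [← mul_assoc, exp_mul_resolventKernel hσ]
  filter_upwards [h1] with s hs hpos
  exact (mul_eq_zero.1 hs).resolve_left (resolventKernel_ne_zero hpos)

/-- The functionals of a bounded calculus are given by the orbits of the group. -/
theorem IsBoundedSobolevCalculus.memLp_and_isOrbitIntegral
    (hA : (-Complex.I) • A = U.generator) {hv : StronglyAdmissible v} {hω : 0 ≤ ω}
    {Ψ : sobolevAlgebra hv hω →ₙₐ[ℂ] (X →L[ℂ] X)} (hΨ : IsBoundedSobolevCalculus hv hω A Ψ) :
    (∀ (x : X) (x' : StrongDual ℂ X),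
      MemLp (fun s : ℝ => ((Real.exp (-ω * |s|) / v s : ℝ) : ℂ) * x' (U s x)) 2 volume) ∧
    ∀ (f : sobolevAlgebra hv hω) (g : ℝ → ℂ), IsInvFourier v ω (f : ClosedStrip ω → ℂ) g →
      IsOrbitIntegral U g (Ψ f) := by
  suffices key : ∀ (x : X) (x' : StrongDual ℂ X), ∃ u : ℝ → ℂ,
      MemLp (fun s : ℝ => ((Real.exp (-ω * |s|) / v s : ℝ) : ℂ) * u s) 2 volume ∧
      (∀ (f : sobolevAlgebra hv hω) (g : ℝ → ℂ), IsInvFourier v ω (f : ClosedStrip ω → ℂ) g →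
        x' (Ψ f x) = ∫ s, g s * u s) ∧ ∀ᵐ s : ℝ, u s = x' (U s x) by
    have hmem : ∀ (x : X) (x' : StrongDual ℂ X), MemLp (fun s : ℝ =>
        ((Real.exp (-ω * |s|) / v s : ℝ) : ℂ) * x' (U s x)) 2 volume := fun x x' => by
      obtain ⟨u, hu, -, hae⟩ := key x x'
      refine hu.ae_eq ?_
      filter_upwards [hae] with s hs
      rw [hs]
    refine ⟨hmem, fun f g hg x x' => ⟨hg.1.integrable_mul hv (hmem x x'), ?_⟩⟩
    obtain ⟨u, -, hform, hae⟩ := key x x'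
    rw [hform f g hg]
    refine integral_congr_ae ?_
    filter_upwards [hae] with s hs
    rw [hs]
  intro x x'
  obtain ⟨u, hu, hform⟩ := hΨ.exists_density x x'
  refine ⟨u, hu, hform, ?_⟩
  obtain ⟨C, a, hCa⟩ := U.exists_norm_le_exp
  obtain ⟨l₀, hl₀, hres⟩ := hΨ.resolvent
  have hzero : ∀ σ : ℝ, |σ| = 1 → ∀ᵐ s : ℝ, 0 < σ * s → u s - x' (U s x) = 0 := by
    intro σ hσ
    -- Beyond both $\omega$ and `a` the resolvent is computed once by the density `u` and once by
    -- the orbit, so the difference has zero Laplace transform.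
    refine ae_eq_zero_of_integral_resolventKernel_eq_zero (b := max ω a) hσ fun l hl => ?_
    have hlω : ω < σ * l.im := (le_max_left _ _).trans_lt hl
    have hla : a < σ * l.im := (le_max_right _ _).trans_lt hl
    have hlabs : ω < |l.im| :=
      hlω.trans_le ((le_abs_self _).trans_eq (by rw [abs_mul, hσ, one_mul]))
    have hinv := isInvFourier_resolventKernel hv hω hσ hlω
    have h1 := hinv.1.integrable_mul hv hu
    have h2 := C0Group.integrable_resolventKernel_smul hCa hσ hla x
    have h3 : Integrable fun s => resolventKernel σ l s * x' (U s x) := by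
      simpa using x'.integrable_comp h2
    obtain ⟨r, hr, hR⟩ := MapsToResolvent.of_mapsToResolvent hl₀ hlabs hres
    have h4 : IsInvFourier v ω (r : ClosedStrip ω → ℂ) (resolventKernel σ l) := by
      rwa [show (r : ClosedStrip ω → ℂ) = _ from funext hr]
    have h5 : x' (Ψ r x) = ∫ s, resolventKernel σ l s * x' (U s x) := by
      rw [hR.apply_eq_integral hA hCa hσ hla, ← ContinuousLinearMap.integral_comp_comm _ h2]
      simp
    simp only [mul_sub]
    exact ⟨h1.sub h3, by rw [integral_sub h1 h3, ← h5, ← hform r _ h4, sub_self]⟩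
  have hne : ∀ᵐ s : ℝ, s ≠ 0 := by
    simp [ae_iff, measure_singleton]
  filter_upwards [hzero 1 abs_one, hzero (-1) (by simp), hne] with s h1 h2 h3
  rcases lt_or_gt_of_ne h3 with h | h
  · exact sub_eq_zero.1 (h2 (by linarith))
  · exact sub_eq_zero.1 (h1 (by linarith))

end Calculus

end SobolevCalculus

theorem mainTheorem11 {X : Type*} [NormedAddCommGroup X] [NormedSpace ℂ X] [CompleteSpace X]
    (U : SobolevCalculus.C0Group X) (A : X →ₗ.[ℂ] X) (hA : (-Complex.I) • A = U.generator)
    {ω : ℝ} (hω : 0 ≤ ω) {v : ℝ → ℝ} (hv : SobolevCalculus.StronglyAdmissible v) :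
    ((∀ (x : X) (x' : StrongDual ℂ X),
        MemLp (fun s : ℝ => ((Real.exp (-ω * |s|) / v s : ℝ) : ℂ) * x' (U s x)) 2 volume) ↔
      SobolevCalculus.HasBoundedSobolevCalculus hv hω A) ∧
    ∀ Ψ : SobolevCalculus.sobolevAlgebra hv hω →ₙₐ[ℂ] (X →L[ℂ] X),
      SobolevCalculus.IsBoundedSobolevCalculus hv hω A Ψ →
        (∀ l : ℂ, ω < |l.im| → SobolevCalculus.MapsToResolvent hv hω A Ψ l) ∧
        ∀ (f : SobolevCalculus.sobolevAlgebra hv hω) (g : ℝ → ℂ),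
          SobolevCalculus.IsInvFourier v ω f g →
            ∀ (x : X) (x' : StrongDual ℂ X),
              Integrable (fun s : ℝ => g s * x' (U s x)) volume ∧
                x' (Ψ f x) = ∫ s : ℝ, g s * x' (U s x) := by
  refine ⟨⟨fun h => SobolevCalculus.hasBoundedSobolevCalculus_of_memLp hA hv hω h,
    fun ⟨Ψ, hΨ⟩ => (hΨ.memLp_and_isOrbitIntegral hA).1⟩, fun Ψ hΨ => ⟨fun l hl => ?_, ?_⟩⟩
  · obtain ⟨l₀, hl₀, hres⟩ := hΨ.resolvent
    exact hres.of_mapsToResolvent hl₀ hl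
  · exact (hΨ.memLp_and_isOrbitIntegral hA).2
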